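/- **Setting.** Consider a time-varying linear system $x_{t+1}=A_tx_t+B_tu_t+w_t$ with $x_t\in\mathbb R^{n}$, $u_t\in\mathbb R^{m}$ and initial state $x_1=w_0$ (for instance $w_0=0$), stage costs $c_t:\mathbb R^{n}\times\mathbb R^{m}\to\mathbb R$, and a given sequence of matrices $K_t$. Norms are Euclidean and spectral. For a horizon $T$ assume: * $\|w_t\|\le W$ for $0\le t\le T$, and $\|B_t\|\le C_B$, $\|K_t\|\le\kappa$ for $1\le t\le T$; * $K_{1:T}$ is $(\kappa,\delta)$ sequentially stabilizing: $\big\|\prod_{t=s}^{r}(A_t+B_tK_t)\big\|<\kappa(1-\delta)^{s-r+1}$ for all $1\le r\le s\le T$, where $0<\delta<1$; * for $1\le t\le T$, $c_t$ is differentiable, $\alpha$-strongly convex ($\alpha>0$), and $\|\nabla c_t(x,u)\|\le L\max\{1,\|x\|+\|u\|\}$ for all $x,u$. Let $x^{\rm nat}_{t+1}=\sum_{i=0}^{t}\big(\prod_{j=0}^{i-1}(A_{t-j}+B_{t-j}K_{t-j})\big)w_{t-i}$ for $t\ge0$ and $x^{\rm nat}_s=0$ for $s\le0$. For $M=(M^{[1]},\dots,M^{[H]})\in(\mathbb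 R^{m\times n})^H$, disturbance response control with parameters $M_t$ plays $u_t=K_tx_t+\sum_{i=0}^{H-1}M_t^{[i+1]}x^{\rm nat}_{t-i}$. Let $\mathcal M=\{M:\sum_{i=1}^H\|M^{[i]}\|\le\gamma\}$; the policy class $\Pi_{\rm DRC}$ consists of these controls with $M_t=M$ constant, $M\in\mathcal M$. **Losses.** For $t>H$ let $\hat x_t$ be the state reached at time $t$ from state $0$ at time $t-H$ under the dynamics with the controls $K_s\hat x_s+\sum_iM_s^{[i+1]}x^{\rm nat}_{s-i}$, $t-H\le s<t$; for $t\le H$ let $\hat x_t=x_t$. Put $f_t(M_{t-H},\dots,M_t)=c_t\big(\hat x_t,\,K_t\hat x_t+\sum_iM_t^{[i+1]}x^{\rm nat}_{t-i}\big)$ and $\tilde f_t(M)=f_t(M,\dots,M)=c_t(Y_tM+\zeta_t)$, where $Y_t$ is the linear part of the affine map from $M$ to the pair at which $c_t$ is evaluated. **DRC-ONS.** Start from any $M_1\in\mathcal M$ (with $M_t=M_1$ for $t<1$) and play the control above with $M_t$, updated by Semi-ONS with step size $\eta$ and regularization $\lambda$: with $\Lambda_t=\lambda I+\sum_{s=1}^{t}Y_s^{\top}Y_s$,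 $$M_{t+1}=\arg\min_{M\in\mathcal M}\big\langle M-\tilde M_{t+1},\Lambda_t(M-\tilde M_{t+1})\big\rangle,\qquad \tilde M_{t+1}=M_t-\eta\Lambda_t^{-1}\nabla\tilde f_t(M_t),$$ in the Euclidean (Frobenius) structure of the parameter space. **Theorem.** There is an absolute $k\in\mathbb N$ such that for all $n,m,W,\kappa,\delta,C_B,\gamma,\alpha,L$ and all $\eta\ge1/\alpha$, $\lambda>0$, $b$ there is a constant $C$, depending only on these quantities, such that the following holds for all $T\ge2$, all memory lengths $H$ with $\tfrac1\delta\log T\le H\le b\log T$, and all systems, disturbances, costs and $K_t$ satisfying the assumptions above. Let $(x_t,u_t)$ and $M_t$ be the states, controls and parameters of DRC-ONS. Then $$\sum_{t=1}^{T}c_t(x_t,u_t)-\min_{\pi\in\Pi_{\rm DRC}}\sum_{t=1}^{T}c_t(x^\pi_t,u^\pi_t)\le C(\log T)^k$$ and the stability gap satisfies $$\sum_{t=1}^{T}\big|f_t(M_{t-H},\dots,M_t)-\tilde f_t(M_t)\big|\le C(\log T)^k.$$ -/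

import Mathlib

/-- The Euclidean space `ℝⁿ`. Matrices are represented by the continuous linear maps between these
spaces, whose norm is the spectral norm. -/
abbrev Vec (n : ℕ) : Type := EuclideanSpace ℝ (Fin n)

/-- Pairs `(x, u)` of a state and a control, with the Euclidean norm of `ℝⁿ⁺ᵐ`. -/
abbrev StateControl (n m : ℕ) : Type := WithLp 2 (Vec n × Vec m)

/-- Parameters `M = (M^[1], …, M^[H])` of `m × n` matrices, with the Euclidean (Frobenius) structure.
The entry `M (i, a, b)` is the entry `(a, b)` of the matrix `M^[i+1]`. -/
abbrev DRCParam (n m H : ℕ) : Type := EuclideanSpace ℝ (Fin H × Fin m × Fin n)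

namespace DRCParam

variable {n m H : ℕ}

/-- The matrix `M^[i+1]`. -/
noncomputable def block (M : DRCParam n m H) (i : Fin H) : Vec n →L[ℝ] Vec m :=
  LinearMap.toContinuousLinearMap (Matrix.toEuclideanLin (Matrix.of fun a b => M (i, a, b)))

theorem block_add (M N : DRCParam n m H) (i : Fin H) : (M + N).block i = M.block i + N.block i := by
  have h : (Matrix.of fun a b => (M + N) (i, a, b))
      = (Matrix.of fun a b => M (i, a, b)) + Matrix.of fun a b => N (i, a, b) := by
    ext a b; simp
  simp only [block, h, map_add]

theorem block_smul (r : ℝ) (M : DRCParam n m H) (i : Fin H) : (r • M).block i = r • M.block i := by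
  have h : (Matrix.of fun a b => (r • M) (i, a, b)) = r • Matrix.of fun a b => M (i, a, b) := by
    ext a b; simp
  simp only [block, h, map_smul]

/-- The parameters with `∑ᵢ ‖M^[i]‖ ≤ γ` (spectral norms). -/
def constraintSet (n m H : ℕ) (γ : ℝ) : Set (DRCParam n m H) :=
  {M | ∑ i, ‖M.block i‖ ≤ γ}

end DRCParam

/-- The data of an online control problem `x_{t+1} = A_t x_t + B_t u_t + w_t` with costs `c_t` and a
sequence of linear controllers `K_t`. Times are `1, 2, …`; the vector `w 0` is the initial state
`x_1`. -/
structure LTVProblem (n m : ℕ) where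
  A : ℕ → Vec n →L[ℝ] Vec n
  B : ℕ → Vec m →L[ℝ] Vec n
  K : ℕ → Vec n →L[ℝ] Vec m
  w : ℕ → Vec n
  c : ℕ → StateControl n m → ℝ

namespace LTVProblem

variable {n m : ℕ} (S : LTVProblem n m)

/-- `A_t + B_t K_t` -/
noncomputable def closedLoop (t : ℕ) : Vec n →L[ℝ] Vec n := S.A t + S.B t ∘L S.K t

/-- `closedLoopProd r k` is the product of `A_t + B_t K_t` over `t = r, …, r + k - 1`, with later
times on the left. -/
noncomputable def closedLoopProd (r : ℕ) : ℕ → (Vec n →L[ℝ] Vec n)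
  | 0 => ContinuousLinearMap.id ℝ (Vec n)
  | k + 1 => S.closedLoop (r + k) ∘L closedLoopProd r k

/-- The sequence `K_t` is `(κ, δ)` sequentially stabilizing: over every nonempty interval
`{r, …, r + k - 1} ⊆ {1, …, T}` the product of `A_t + B_t K_t` has norm less than `κ (1 - δ) ^ k`. -/
def SeqStabilizing (T : ℕ) (κ δ : ℝ) : Prop :=
  ∀ r k : ℕ, 1 ≤ r → 1 ≤ k → r + k ≤ T + 1 → ‖S.closedLoopProd r k‖ < κ * (1 - δ) ^ k

/-- Nature's state `x^nat_{t+1} = ∑_{i=0}^{t} (∏_{j<i} (A_{t-j} + B_{t-j} K_{t-j})) w_{t-i}`, written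
as a recursion; it vanishes before time `1`. -/
noncomputable def xnat : ℕ → Vec n
  | 0 => 0
  | t + 1 => S.closedLoop t (xnat t) + S.w t

variable {H : ℕ}

/-- The linear map `M ↦ ∑_{i=0}^{H-1} M^[i+1] x^nat_{t-i}`, with `x^nat_s = 0` for `s ≤ 0`. -/
noncomputable def response (H t : ℕ) : DRCParam n m H →L[ℝ] Vec m :=
  LinearMap.toContinuousLinearMap
    { toFun := fun M => ∑ i : Fin H, M.block i (S.xnat (t - i))
      map_add' := fun M N => by
        simp [DRCParam.block_add, Finset.sum_add_distrib]
      map_smul' := fun r M => by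
        simp [DRCParam.block_smul, Finset.smul_sum] }

/-- The disturbance response control `u_t = K_t x_t + ∑_{i=0}^{H-1} M^[i+1] x^nat_{t-i}`. -/
noncomputable def control (t : ℕ) (x : Vec n) (M : DRCParam n m H) : Vec m :=
  S.K t x + S.response H t M

/-- The state at time `t` of the system that is at `0` at time `r` (and before), and is then driven by
the disturbance response controls with parameter `M s` at time `s`. -/
noncomputable def stateFrom (r : ℕ) (M : ℕ → DRCParam n m H) : ℕ → Vec n
  | 0 => 0
  | t + 1 =>
    if t < r then 0
    else S.A t (stateFrom r M t) + S.B t (S.control t (stateFrom r M t) (M t)) + S.w t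

/-- The state `x_t` under the parameters `M s`, `s < t`. In particular `x_1 = w_0`. -/
noncomputable def state (M : ℕ → DRCParam n m H) (t : ℕ) : Vec n := S.stateFrom 0 M t

/-- The proxy state, which starts at `0` at time `t - H`; for `t ≤ H` it is the state itself. -/
noncomputable def proxyState (M : ℕ → DRCParam n m H) (t : ℕ) : Vec n := S.stateFrom (t - H) M t

/-- The cost `c_t(x_t, u_t)` at time `t` of playing the parameters `M s`. -/
noncomputable def cost (M : ℕ → DRCParam n m H) (t : ℕ) : ℝ :=
  S.c t (WithLp.toLp 2 (S.state M t, S.control t (S.state M t) (M t)))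

/-- The loss with memory `f_t(M_{t-H}, …, M_t)`: the cost at the proxy state. -/
noncomputable def memoryLoss (M : ℕ → DRCParam n m H) (t : ℕ) : ℝ :=
  S.c t (WithLp.toLp 2 (S.proxyState M t, S.control t (S.proxyState M t) (M t)))

/-- The surrogate loss `f̃_t(M) = f_t(M, …, M)`. -/
noncomputable def surrogateLoss (t : ℕ) (M : DRCParam n m H) : ℝ := S.memoryLoss (fun _ => M) t

/-- The linear part of `M ↦ stateFrom r (M, M, …) t`. -/
noncomputable def stateLin (H r : ℕ) : ℕ → (DRCParam n m H →L[ℝ] Vec n)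
  | 0 => 0
  | t + 1 =>
    if t < r then 0
    else S.closedLoop t ∘L stateLin H r t + S.B t ∘L S.response H t

/-- The linear part of the affine map that sends `M` to the pair of proxy state and control at time
`t` at which `surrogateLoss t M` evaluates `c_t`. -/
noncomputable def proxyLin (H t : ℕ) : DRCParam n m H →L[ℝ] StateControl n m :=
  (WithLp.prodContinuousLinearEquiv 2 ℝ (Vec n) (Vec m)).symm.toContinuousLinearMap ∘L
    (S.stateLin H (t - H) t).prod (S.K t ∘L S.stateLin H (t - H) t + S.response H t)

/-- The Semi-ONS preconditioner `Λ_t = lam I + ∑_{s=1}^{t} Y_sᵀ Y_s` with `Y_s = proxyLin H s`. -/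
noncomputable def precond (H : ℕ) (lam : ℝ) (t : ℕ) : DRCParam n m H →L[ℝ] DRCParam n m H :=
  lam • ContinuousLinearMap.id ℝ (DRCParam n m H) +
    ∑ s ∈ Finset.Icc 1 t, ContinuousLinearMap.adjoint (S.proxyLin H s) ∘L S.proxyLin H s

/-- The Newton point `M - η Λ_t⁻¹ ∇f̃_t(M)`. -/
noncomputable def newtonPoint (η lam : ℝ) (t : ℕ) (M : DRCParam n m H) : DRCParam n m H :=
  M - η • (S.precond H lam t).inverse (gradient (S.surrogateLoss t) M)

/-- The Semi-ONS update after round `t`: the projection of the Newton point onto the constraint set,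
in the norm given by `Λ_t`. -/
noncomputable def semiONS (γ η lam : ℝ) (t : ℕ) (M : DRCParam n m H) : DRCParam n m H :=
  Classical.epsilon fun N : DRCParam n m H =>
    N ∈ DRCParam.constraintSet n m H γ ∧
    IsMinOn (fun Z => inner ℝ (Z - S.newtonPoint η lam t M)
        (S.precond H lam t (Z - S.newtonPoint η lam t M)))
      (DRCParam.constraintSet n m H γ) N

/-- The parameters `M_t` played by DRC-ONS with initialization `M₁` (and `M_t = M₁` for `t < 1`). -/
noncomputable def drcONS (γ η lam : ℝ) (M₁ : DRCParam n m H) : ℕ → DRCParam n m H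
  | 0 => M₁
  | t + 1 => if t = 0 then M₁ else S.semiONS γ η lam t (drcONS γ η lam M₁ t)

/-- The stability gap over `{1, …, T}` of an algorithm that plays the parameters `M t`. -/
noncomputable def stabilityGap (T : ℕ) (M : ℕ → DRCParam n m H) : ℝ :=
  ∑ t ∈ Finset.Icc 1 T, |S.memoryLoss M t - S.surrogateLoss t (M t)|

end LTVProblem

/-! The regret splits into four parts: the error of truncating the state's history to `H` rounds,
once for the algorithm and once for the comparator; the stability gap; and the regret of Semi-ONS on
the surrogate losses. Truncation costs `O((1 - δ)^H) = O(1/T)` per round, because `log T ≤ δ H`.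

The other two parts are governed by the leverages `q_t = tr (Λ_t⁻¹ Y_tᵀ Y_t)`. By the determinant
inequality `Matrix.PosDef.det_le_mul_exp_trace`, `q_t` is at most the increment of `log det Λ_t`, so
the leverages sum to polylogarithmic size (`sum_leverage_le`).

Surrogate regret (`IsOnlineNewton.regret_le`): strong convexity of `c_t` gives curvature `α ‖Y_t
·‖²`. Since `η α ≥ 1`, this pays for the growth of `Λ_t` in the telescoping sum, and what remains is
the initial distance plus `η/2 ∑ ‖g_t‖² q_t`.

Stability gap: the crude bound by the size of the steps would involve sums of `√q_t`. Instead, the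
effect of a parameter change on the control at an earlier round `s` is seen through `Y_s` itself
(`IsStableOn.norm_response_le_proxyLin`), and `‖Y_s (M_{j+1} - M_j)‖ ≤ η G √(q_s q_j)` for `s ≤ j`,
because `Λ_s ≤ Λ_j` (`IsOnlineNewton.norm_apply_step_le`). The product of two square roots is at
most a sum of leverages, so adding over windows of length `H` costs only a factor of order `H²`. -/

/-! ### Determinants, leverages and the elliptical potential. -/

-- Write `A⁻¹ = Pᴴ P`. The eigenvalues `μ` of `P C Pᴴ` are nonnegative and satisfy `μ ≤ exp (μ -
-- 1)`; multiply these inequalities. This is concavity of `log det` in a form that allows singular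
-- `C`.
open scoped MatrixOrder in
theorem Matrix.PosDef.det_le_mul_exp_trace {ι : Type*} [Fintype ι] [DecidableEq ι]
    {A C : Matrix ι ι ℝ} (hA : A.PosDef) (hC : C.PosSemidef) :
    C.det ≤ A.det * Real.exp ((A⁻¹ * C).trace - Fintype.card ι) := by
  obtain ⟨P, hP⟩ := CStarAlgebra.nonneg_iff_eq_star_mul_self.mp hA.inv.posSemidef.nonneg
  rw [Matrix.star_eq_conjTranspose] at hP
  have hD : (P * C * P.conjTranspose).PosSemidef := hC.mul_mul_conjTranspose_same P
  have hdet : (P * C * P.conjTranspose).det = A⁻¹.det * C.det := by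
    rw [hP]; simp only [Matrix.det_mul]; ring
  have htr : (P * C * P.conjTranspose).trace = (A⁻¹ * C).trace := by
    rw [hP, Matrix.trace_mul_comm, Matrix.mul_assoc]
  have key : (P * C * P.conjTranspose).det ≤ Real.exp ((A⁻¹ * C).trace - Fintype.card ι) := by
    rw [← htr, hD.isHermitian.det_eq_prod_eigenvalues, hD.isHermitian.trace_eq_sum_eigenvalues]
    have : (∑ i, ((hD.isHermitian.eigenvalues i : ℝ) : ℝ)) - (Fintype.card ι : ℝ)
        = ∑ i, (hD.isHermitian.eigenvalues i - 1) := by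
      simp [Finset.sum_sub_distrib]
    simp only [RCLike.ofReal_real_eq_id, id]
    rw [this, Real.exp_sum]
    refine Finset.prod_le_prod (fun i _ => hD.eigenvalues_nonneg i) fun i _ => ?_
    linarith [Real.add_one_le_exp (hD.isHermitian.eigenvalues i - 1)]
  have hAdet : 0 < A.det := hA.det_pos
  have h1 : A.det * A⁻¹.det = 1 := by
    rw [← Matrix.det_mul, Matrix.mul_nonsing_inv _ hAdet.ne'.isUnit, Matrix.det_one]
  calc C.det = A.det * (A⁻¹.det * C.det) := by rw [← mul_assoc, h1, one_mul]
    _ ≤ _ := by rw [← hdet]; gcongr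

section Operator

variable {E : Type*} [NormedAddCommGroup E] [InnerProductSpace ℝ E] [FiniteDimensional ℝ E]

theorem LinearMap.IsPositive.det_le_mul_exp_trace {A B C : E →ₗ[ℝ] E} (hA : A.IsPositive)
    (hAB : B ∘ₗ A = LinearMap.id) (hC : C.IsPositive) :
    0 < LinearMap.det A ∧ LinearMap.det C ≤
      LinearMap.det A * Real.exp (LinearMap.trace ℝ E (B ∘ₗ C) - Module.finrank ℝ E) := by
  let b := stdOrthonormalBasis ℝ E
  let f : (E →ₗ[ℝ] E) → Matrix _ _ ℝ := LinearMap.toMatrix b.toBasis b.toBasis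
  have hfA : (f A).PosSemidef := (LinearMap.posSemidef_toMatrix_iff b).2 hA
  have hfC : (f C).PosSemidef := (LinearMap.posSemidef_toMatrix_iff b).2 hC
  have hBA : f B * f A = 1 := by
    simp only [f]
    rw [← LinearMap.toMatrix_comp, hAB, LinearMap.toMatrix_id]
  have hdet : (f A).det ≠ 0 := by
    intro h0
    have := congrArg Matrix.det hBA
    simp [h0] at this
  have hpd : (f A).PosDef :=
    hfA.posDef_iff_isUnit.2 ((Matrix.isUnit_iff_isUnit_det _).2 hdet.isUnit)
  have hinv : (f A)⁻¹ = f B := Matrix.inv_eq_left_inv hBA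
  have h := hpd.det_le_mul_exp_trace hfC
  have hpos := hpd.det_pos
  have e1 : (f A).det = LinearMap.det A := LinearMap.det_toMatrix _ _
  have e2 : (f C).det = LinearMap.det C := LinearMap.det_toMatrix _ _
  have e3 : ((f A)⁻¹ * f C).trace = LinearMap.trace ℝ E (B ∘ₗ C) := by
    rw [hinv, LinearMap.trace_eq_matrix_trace ℝ b.toBasis]
    simp only [f]
    rw [← LinearMap.toMatrix_comp]
  rw [e1, e2, e3, Fintype.card_fin] at h
  exact ⟨e1 ▸ hpos, h⟩

variable {F : Type*} [NormedAddCommGroup F] [InnerProductSpace ℝ F] [FiniteDimensional ℝ F]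

open ContinuousLinearMap in
/-- The regularized Gram operator `lam I + ∑_{s=1}^{t} Y_sᵀ Y_s`. -/
noncomputable def regGram (lam : ℝ) (Y : ℕ → E →L[ℝ] F) (t : ℕ) : E →L[ℝ] E :=
  lam • ContinuousLinearMap.id ℝ E + ∑ s ∈ Finset.Icc 1 t, adjoint (Y s) ∘L Y s

/-- The leverage `tr (Λ_t⁻¹ Y_tᵀ Y_t)` of the round `t`, with `Λ_t = regGram lam Y t`. -/
noncomputable def leverage (lam : ℝ) (Y : ℕ → E →L[ℝ] F) (t : ℕ) : ℝ :=
  LinearMap.trace ℝ E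
    ((regGram lam Y t).inverse ∘L (ContinuousLinearMap.adjoint (Y t) ∘L Y t) : E →L[ℝ] E)

variable {lam : ℝ} (Y : ℕ → E →L[ℝ] F)

theorem regGram_succ (t : ℕ) : regGram lam Y (t + 1) =
    regGram lam Y t + ContinuousLinearMap.adjoint (Y (t + 1)) ∘L Y (t + 1) := by
  simp only [regGram, Finset.sum_Icc_succ_top (Nat.le_add_left 1 t), add_assoc]

theorem inner_regGram_self (t : ℕ) (v : E) :
    inner ℝ v (regGram lam Y t v) = lam * ‖v‖ ^ 2 + ∑ s ∈ Finset.Icc 1 t, ‖Y s v‖ ^ 2 := by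
  simp only [regGram, add_apply, smul_apply,
    ContinuousLinearMap.id_apply, sum_apply, inner_add_right, inner_sum,
    real_inner_smul_right, ContinuousLinearMap.comp_apply,
    ContinuousLinearMap.adjoint_inner_right, real_inner_self_eq_norm_sq]

theorem inner_regGram_symm (t : ℕ) (u v : E) :
    inner ℝ u (regGram lam Y t v) = inner ℝ (regGram lam Y t u) v := by
  simp only [regGram, add_apply, smul_apply,
    ContinuousLinearMap.id_apply, sum_apply, inner_add_right, inner_sum,
    real_inner_smul_right, ContinuousLinearMap.comp_apply, inner_add_left, sum_inner,
    real_inner_smul_left,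
    ContinuousLinearMap.adjoint_inner_right, ContinuousLinearMap.adjoint_inner_left]

theorem regGram_mono (s t : ℕ) (hst : s ≤ t) (v : E) :
    inner ℝ v (regGram lam Y s v) ≤ inner ℝ v (regGram lam Y t v) := by
  rw [inner_regGram_self, inner_regGram_self]
  gcongr

theorem regGram_isInvertible (hlam : 0 < lam) (t : ℕ) : (regGram lam Y t).IsInvertible := by
  have hinj : Function.Injective (regGram lam Y t).toLinearMap := by
    refine (injective_iff_map_eq_zero _).2 fun v hv => ?_
    have h := inner_regGram_self (lam := lam) Y t v
    have hv' : regGram lam Y t v = 0 := hv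
    rw [hv', inner_zero_right] at h
    have h2 : 0 ≤ ∑ s ∈ Finset.Icc 1 t, ‖Y s v‖ ^ 2 := Finset.sum_nonneg fun _ _ => by positivity
    have h3 : ‖v‖ ^ 2 = 0 := by nlinarith [sq_nonneg ‖v‖]
    simpa using h3
  exact ⟨(LinearEquiv.ofInjectiveEndo _ hinj).toContinuousLinearEquiv, by ext v; rfl⟩

theorem inner_regGram_self_nonneg (hlam : 0 < lam) (t : ℕ) (v : E) :
    0 ≤ inner ℝ v (regGram lam Y t v) := by
  rw [inner_regGram_self]
  have h2 : 0 ≤ ∑ s ∈ Finset.Icc 1 t, ‖Y s v‖ ^ 2 := Finset.sum_nonneg fun _ _ => by positivity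
  positivity

theorem regGram_isPositive (hlam : 0 < lam) (t : ℕ) :
    (regGram lam Y t).toLinearMap.IsPositive := by
  refine ⟨fun u v => (inner_regGram_symm Y t u v).symm, fun v => ?_⟩
  have := inner_regGram_self_nonneg Y hlam t v
  rw [inner_regGram_symm] at this
  simpa using this

/-- Cauchy–Schwarz for a pair of dual norms. -/
theorem inner_sq_le_regGram (hlam : 0 < lam) (t : ℕ) (u v : E) :
    inner ℝ u v ^ 2 ≤
      inner ℝ u ((regGram lam Y t).inverse u) * inner ℝ v (regGram lam Y t v) := by
  have hinv := regGram_isInvertible Y hlam t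
  set z := (regGram lam Y t).inverse u
  have hz : regGram lam Y t z = u := hinv.self_apply_inverse u
  -- The quadratic in `r` is the `Λ_t`-form of `r v + Λ_t⁻¹ u`, so its discriminant is nonpositive.
  have h : ∀ r : ℝ, 0 ≤ inner ℝ v (regGram lam Y t v) * (r * r) + (2 * inner ℝ u v) * r
      + inner ℝ u z := fun r => by
    have h0 := inner_regGram_self_nonneg Y hlam t (r • v + z)
    have h1 : inner ℝ z (regGram lam Y t v) = inner ℝ u v := by rw [inner_regGram_symm, hz]
    simp only [map_add, map_smul, hz, inner_add_left, inner_add_right, real_inner_smul_left,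
      real_inner_smul_right, h1] at h0
    rw [real_inner_comm u v, real_inner_comm u z] at h0
    linarith
  have := discrim_le_zero h
  simp only [discrim] at this
  linarith

/-- Cyclicity moves the trace to `F`, where it becomes a sum of squared dual norms of the rows of
`Y_t`. -/
theorem leverage_eq_sum {ι : Type*} [Fintype ι] (b : OrthonormalBasis ι ℝ F) (t : ℕ) :
    leverage lam Y t = ∑ k, inner ℝ (ContinuousLinearMap.adjoint (Y t) (b k))
      ((regGram lam Y t).inverse (ContinuousLinearMap.adjoint (Y t) (b k))) := by
  have : leverage lam Y t = LinearMap.trace ℝ F ((Y t).toLinearMap ∘ₗ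
      ((regGram lam Y t).inverse.toLinearMap ∘ₗ
        (ContinuousLinearMap.adjoint (Y t)).toLinearMap)) := by
    rw [LinearMap.trace_comp_comm']; rfl
  rw [this, LinearMap.trace_eq_sum_inner _ b]
  simp [ContinuousLinearMap.adjoint_inner_left]

theorem inner_regGram_inverse_nonneg (hlam : 0 < lam) (t : ℕ) (u : E) :
    0 ≤ inner ℝ u ((regGram lam Y t).inverse u) := by
  have h := inner_regGram_self_nonneg Y hlam t ((regGram lam Y t).inverse u)
  rwa [(regGram_isInvertible Y hlam t).self_apply_inverse, real_inner_comm] at h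

theorem leverage_nonneg (hlam : 0 < lam) (t : ℕ) : 0 ≤ leverage lam Y t := by
  rw [leverage_eq_sum Y (stdOrthonormalBasis ℝ F)]
  exact Finset.sum_nonneg fun k _ => inner_regGram_inverse_nonneg Y hlam t _

/-- The coordinates of `Y_t v` are pairings of `v` with the rows of `Y_t`; apply Cauchy–Schwarz to
each. -/
theorem norm_sq_le_leverage (hlam : 0 < lam) (t : ℕ) (v : E) :
    ‖Y t v‖ ^ 2 ≤ leverage lam Y t * inner ℝ v (regGram lam Y t v) := by
  let b := stdOrthonormalBasis ℝ F
  rw [leverage_eq_sum Y b, ← b.sum_sq_norm_inner_right, Finset.sum_mul]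
  refine Finset.sum_le_sum fun k _ => ?_
  rw [Real.norm_eq_abs, sq_abs, ← ContinuousLinearMap.adjoint_inner_left]
  exact inner_sq_le_regGram Y hlam t _ v

/-- Bounds the squared length of a Newton step. With `v = Λ_t⁻¹ u`, both `⟨u, v⟩ ≤ ‖g‖ ‖Y_t v‖` and
`‖Y_t v‖² ≤ q_t ⟨u, v⟩` hold; square the first and cancel one factor `⟨u, v⟩`. -/
theorem inner_inverse_adjoint_le_leverage (hlam : 0 < lam) (t : ℕ) (g : F) :
    inner ℝ (ContinuousLinearMap.adjoint (Y t) g)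
      ((regGram lam Y t).inverse (ContinuousLinearMap.adjoint (Y t) g))
      ≤ ‖g‖ ^ 2 * leverage lam Y t := by
  set u := ContinuousLinearMap.adjoint (Y t) g with hu
  set v := (regGram lam Y t).inverse u with hv
  have h1 := norm_sq_le_leverage Y hlam t v
  rw [hv, (regGram_isInvertible Y hlam t).self_apply_inverse, ← hv, real_inner_comm] at h1
  have h2 : inner ℝ u v ≤ ‖g‖ * ‖Y t v‖ := by
    rw [hu, ContinuousLinearMap.adjoint_inner_left]
    exact real_inner_le_norm _ _
  have h0 : 0 ≤ inner ℝ u v := inner_regGram_inverse_nonneg Y hlam t u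
  rcases h0.eq_or_lt with h | h
  · rw [← h]
    have := leverage_nonneg Y hlam t
    positivity
  · have h3 : inner ℝ u v ^ 2 ≤ ‖g‖ ^ 2 * (leverage lam Y t * inner ℝ u v) := by
      calc inner ℝ u v ^ 2 ≤ (‖g‖ * ‖Y t v‖) ^ 2 := by gcongr
        _ = ‖g‖ ^ 2 * ‖Y t v‖ ^ 2 := by ring
        _ ≤ _ := by gcongr
    refine le_of_mul_le_mul_right ?_ h
    linarith

/-- The determinant inequality for `Λ_{t+1}` and `Λ_t`, where `tr (Λ_{t+1}⁻¹ Λ_t) = d - q_{t+1}`. -/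
theorem leverage_succ_le (hlam : 0 < lam) (t : ℕ) :
    leverage lam Y (t + 1) ≤ Real.log (LinearMap.det (regGram lam Y (t + 1)).toLinearMap)
      - Real.log (LinearMap.det (regGram lam Y t).toLinearMap) := by
  have hinv : ∀ t, (regGram lam Y t).inverse.toLinearMap ∘ₗ (regGram lam Y t).toLinearMap
      = LinearMap.id := fun t => by
    ext v
    exact (regGram_isInvertible Y hlam t).inverse_apply_self v
  have h := (regGram_isPositive Y hlam (t + 1)).det_le_mul_exp_trace (hinv _)
    (regGram_isPositive Y hlam t)
  have h0 := ((regGram_isPositive Y hlam t).det_le_mul_exp_trace (hinv _)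
    (regGram_isPositive Y hlam t)).1
  have htr : LinearMap.trace ℝ E ((regGram lam Y (t + 1)).inverse.toLinearMap ∘ₗ
      (regGram lam Y t).toLinearMap) = Module.finrank ℝ E - leverage lam Y (t + 1) := by
    rw [eq_sub_iff_add_eq, leverage, ← map_add, ← LinearMap.trace_id, ← hinv (t + 1)]
    congr 1
    rw [regGram_succ Y t]
    ext v
    simp
  rw [htr] at h
  have h2 := Real.log_le_log h0 h.2
  rw [Real.log_mul h.1.ne' (Real.exp_pos _).ne', Real.log_exp] at h2
  linarith

theorem sum_leverage_le_log_det (hlam : 0 < lam) (T : ℕ) :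
    ∑ t ∈ Finset.Icc 1 T, leverage lam Y t ≤
      Real.log (LinearMap.det (regGram lam Y T).toLinearMap)
        - Real.log (LinearMap.det (regGram lam Y 0).toLinearMap) := by
  induction T with
  | zero => simp
  | succ T ih =>
    rw [Finset.sum_Icc_succ_top (Nat.le_add_left 1 T)]
    linarith [leverage_succ_le Y hlam T]

/-- The elliptical potential lemma. -/
theorem sum_leverage_le (hlam : 0 < lam) (T : ℕ) {R : ℝ}
    (hY : ∀ t ∈ Finset.Icc 1 T, ∀ v, ‖Y t v‖ ≤ R * ‖v‖) :
    ∑ t ∈ Finset.Icc 1 T, leverage lam Y t ≤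
      Module.finrank ℝ E * Real.log (1 + T * R ^ 2 / lam) := by
  refine (sum_leverage_le_log_det Y hlam T).trans ?_
  set d := Module.finrank ℝ E with hd
  have h0 : LinearMap.det (regGram lam Y 0).toLinearMap = lam ^ d := by
    have : (regGram lam Y 0).toLinearMap = lam • LinearMap.id := by
      ext v; simp [regGram]
    rw [this, LinearMap.det_smul, LinearMap.det_id, mul_one]
  -- Every diagonal entry of `Λ_T` in an orthonormal basis is at most `τ`. Comparison with `τ I`
  -- makes the exponent in the determinant inequality nonpositive, so `det Λ_T ≤ τ ^ d`.
  set τ := lam + T * R ^ 2 with hτ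
  have hτ0 : 0 < τ := by positivity
  have hpos : (τ • LinearMap.id : E →ₗ[ℝ] E).IsPositive :=
    LinearMap.isPositive_id.smul_of_nonneg hτ0.le
  have hAB : (τ⁻¹ • LinearMap.id : E →ₗ[ℝ] E) ∘ₗ (τ • LinearMap.id) = LinearMap.id := by
    ext v; simp [smul_smul, hτ0.ne']
  have h := (hpos.det_le_mul_exp_trace hAB (regGram_isPositive Y hlam T)).2
  have htr : LinearMap.trace ℝ E ((τ⁻¹ • LinearMap.id : E →ₗ[ℝ] E) ∘ₗ
      (regGram lam Y T).toLinearMap) ≤ d := by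
    have e : (τ⁻¹ • LinearMap.id : E →ₗ[ℝ] E) ∘ₗ (regGram lam Y T).toLinearMap
      = τ⁻¹ • (regGram lam Y T).toLinearMap := by ext v; simp
    rw [e, map_smul, LinearMap.trace_eq_sum_inner _ (stdOrthonormalBasis ℝ E), smul_eq_mul]
    have : ∑ i, inner ℝ (stdOrthonormalBasis ℝ E i)
        ((regGram lam Y T).toLinearMap (stdOrthonormalBasis ℝ E i)) ≤ ∑ i : Fin d, τ := by
      refine Finset.sum_le_sum fun i _ => ?_
      rw [ContinuousLinearMap.coe_coe, inner_regGram_self,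
        (stdOrthonormalBasis ℝ E).orthonormal.1 i]
      have : ∑ s ∈ Finset.Icc 1 T, ‖Y s (stdOrthonormalBasis ℝ E i)‖ ^ 2
          ≤ ∑ s ∈ Finset.Icc 1 T, R ^ 2 := by
        refine Finset.sum_le_sum fun s hs => ?_
        have := hY s hs (stdOrthonormalBasis ℝ E i)
        rw [(stdOrthonormalBasis ℝ E).orthonormal.1 i, mul_one] at this
        gcongr
      simp only [Finset.sum_const, Nat.card_Icc, nsmul_eq_mul, add_tsub_cancel_right] at this
      rw [hτ]
      linarith
    rw [Finset.sum_const, Finset.card_univ, Fintype.card_fin, nsmul_eq_mul] at this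
    calc _ ≤ τ⁻¹ * (d * τ) := by gcongr
      _ = d := by field_simp
  have hdetT : LinearMap.det (regGram lam Y T).toLinearMap ≤ τ ^ d := by
    refine h.trans ?_
    rw [LinearMap.det_smul, LinearMap.det_id, mul_one]
    refine mul_le_of_le_one_right (by positivity) (Real.exp_le_one_iff.2 ?_)
    linarith
  have hdet0 : 0 < LinearMap.det (regGram lam Y T).toLinearMap :=
    ((regGram_isPositive Y hlam T).det_le_mul_exp_trace (B := (regGram lam Y T).inverse.toLinearMap)
      (by ext v; exact (regGram_isInvertible Y hlam T).inverse_apply_self v)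
      (regGram_isPositive Y hlam T)).1
  have h1 := Real.log_le_log hdet0 hdetT
  rw [Real.log_pow] at h1
  rw [h0, Real.log_pow]
  have h2 : 1 + T * R ^ 2 / lam = τ / lam := by rw [hτ]; field_simp
  rw [h2, Real.log_div hτ0.ne' hlam.ne']
  linarith

end Operator

/-! ### Strong convexity and projections. -/

/-- The first-order characterization of strong convexity. -/
theorem StrongConvexOn.add_inner_gradient_le {F : Type*} [NormedAddCommGroup F]
    [InnerProductSpace ℝ F] [CompleteSpace F] {f : F → ℝ} {α : ℝ}
    (hf : StrongConvexOn Set.univ α f) {x : F} (hx : DifferentiableAt ℝ f x) (y : F) :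
    f x + inner ℝ (gradient f x) (y - x) + α / 2 * ‖y - x‖ ^ 2 ≤ f y := by
  have hd : HasDerivAt (fun s : ℝ => f (x + s • (y - x))) (inner ℝ (gradient f x) (y - x)) 0 := by
    rw [inner_gradient_left]
    have h1 : HasDerivAt (fun s : ℝ => x + s • (y - x)) (y - x) 0 := by
      simpa using ((hasDerivAt_id (0 : ℝ)).smul_const (y - x)).const_add x
    have h2 : HasFDerivAt f (fderiv ℝ f x) (x + (0 : ℝ) • (y - x)) := by
      simpa using hx.hasFDerivAt
    exact h2.comp_hasDerivAt 0 h1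
  have ht := hd.tendsto_slope_zero_right
  have hr : Filter.Tendsto (fun s : ℝ => f y - f x - (1 - s) * (α / 2 * ‖y - x‖ ^ 2))
      (nhdsWithin 0 (Set.Ioi 0)) (nhds (f y - f x - (1 - 0) * (α / 2 * ‖y - x‖ ^ 2))) := by
    refine Filter.Tendsto.mono_left ?_ nhdsWithin_le_nhds
    exact (by fun_prop : Continuous fun s : ℝ =>
      f y - f x - (1 - s) * (α / 2 * ‖y - x‖ ^ 2)).tendsto 0
  -- Divide the convexity inequality on the segment from `x` to `y` by `s` and let `s → 0⁺`.
  have hle := le_of_tendsto_of_tendsto ht hr ?_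
  · linarith
  · have h1 : ∀ᶠ s : ℝ in nhdsWithin 0 (Set.Ioi 0), s ∈ Set.Ioo (0 : ℝ) 1 :=
      Ioo_mem_nhdsGT one_pos
    filter_upwards [h1] with s hs
    have h := hf.2 (Set.mem_univ y) (Set.mem_univ x) hs.1.le (sub_nonneg.2 hs.2.le)
      (add_sub_cancel s 1)
    have e : s • y + (1 - s) • x = x + s • (y - x) := by
      rw [smul_sub, sub_smul, one_smul]; abel
    simp only [smul_eq_mul] at h
    rw [e] at h
    simp only [zero_add, zero_smul, add_zero, smul_eq_mul]
    rw [inv_mul_le_iff₀ hs.1]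
    nlinarith

section Projection

variable {E : Type*} [NormedAddCommGroup E] [InnerProductSpace ℝ E]

/-- The projection to a convex set in the seminorm of a positive symmetric operator is
nonexpansive towards the points of the set. -/
theorem IsMinOn.inner_sub_le_of_convex {P : E →L[ℝ] E} (hsymm : ∀ u v, inner ℝ u (P v) = inner ℝ (P u) v)
    (hpos : ∀ v, 0 ≤ inner ℝ v (P v)) {s : Set E} (hs : Convex ℝ s) {p N Z : E} (hN : N ∈ s)
    (hmin : IsMinOn (fun Z => inner ℝ (Z - p) (P (Z - p))) s N) (hZ : Z ∈ s) :
    inner ℝ (N - Z) (P (N - Z)) ≤ inner ℝ (p - Z) (P (p - Z)) := by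
  have hsym' : ∀ u v, inner ℝ u (P v) = inner ℝ v (P u) := fun u v => by
    rw [hsymm, real_inner_comm]
  have hquad : ∀ r ∈ Set.Ioo (0 : ℝ) 1,
      0 ≤ 2 * inner ℝ (N - p) (P (Z - N)) + r * inner ℝ (Z - N) (P (Z - N)) := fun r hr => by
    have hmem : N + r • (Z - N) ∈ s := hs.add_smul_sub_mem hN hZ ⟨hr.1.le, hr.2.le⟩
    have h := isMinOn_iff.1 hmin _ hmem
    have e : N + r • (Z - N) - p = (N - p) + r • (Z - N) := by abel
    rw [e] at h
    simp only [map_add, map_smul, inner_add_left, inner_add_right, real_inner_smul_left,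
      real_inner_smul_right] at h
    rw [hsym' (Z - N) (N - p)] at h
    have : 0 ≤ r * (2 * inner ℝ (N - p) (P (Z - N)) + r * inner ℝ (Z - N) (P (Z - N))) := by
      linarith
    exact nonneg_of_mul_nonneg_right this hr.1
  -- The variational inequality at the minimizer, as the limit `r → 0⁺` of `hquad`.
  have hcross : 0 ≤ inner ℝ (N - p) (P (Z - N)) := by
    by_contra hneg
    push Not at hneg
    have ht : Filter.Tendsto (fun r : ℝ => 2 * inner ℝ (N - p) (P (Z - N))
        + r * inner ℝ (Z - N) (P (Z - N))) (nhdsWithin 0 (Set.Ioi 0))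
        (nhds (2 * inner ℝ (N - p) (P (Z - N)) + 0 * inner ℝ (Z - N) (P (Z - N)))) :=
      ((by fun_prop : Continuous fun r : ℝ => 2 * inner ℝ (N - p) (P (Z - N))
        + r * inner ℝ (Z - N) (P (Z - N))).tendsto 0).mono_left nhdsWithin_le_nhds
    have h1 : ∀ᶠ r : ℝ in nhdsWithin 0 (Set.Ioi 0), r ∈ Set.Ioo (0 : ℝ) 1 :=
      Ioo_mem_nhdsGT one_pos
    have := ge_of_tendsto ht (h1.mono hquad)
    linarith
  have e : p - Z = -((N - p) + (Z - N)) := by abel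
  have e' : N - Z = -(Z - N) := by abel
  rw [e, e']
  simp only [map_neg, inner_neg_neg, map_add, inner_add_left, inner_add_right]
  rw [hsym' (Z - N) (N - p)]
  linarith [hpos (N - p)]

end Projection

/-! ### Online Newton steps: regret and movement. -/

section OnlineNewton

variable {E F : Type*} [NormedAddCommGroup E] [InnerProductSpace ℝ E] [FiniteDimensional ℝ E]
  [NormedAddCommGroup F] [InnerProductSpace ℝ F] [FiniteDimensional ℝ F]

/-- The iterates `x` of an online Newton method with preconditioners `regGram lam Y t` and gradients
`Y_tᵀ g_t`, whose steps are nonexpansive towards the points of `s`. -/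
structure IsOnlineNewton (η lam : ℝ) (s : Set E) (Y : ℕ → E →L[ℝ] F) (g : ℕ → F) (T : ℕ)
    (x : ℕ → E) : Prop where
  mem : ∀ t, x t ∈ s
  step : ∀ t ∈ Finset.Icc 1 T, ∀ Z ∈ s,
    inner ℝ (x (t + 1) - Z) (regGram lam Y t (x (t + 1) - Z)) ≤
      inner ℝ (x t - η • (regGram lam Y t).inverse (ContinuousLinearMap.adjoint (Y t) (g t)) - Z)
        (regGram lam Y t
          (x t - η • (regGram lam Y t).inverse (ContinuousLinearMap.adjoint (Y t) (g t)) - Z))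

namespace IsOnlineNewton

variable {η lam : ℝ} {s : Set E} {Y : ℕ → E →L[ℝ] F} {g : ℕ → F} {T : ℕ} {x : ℕ → E}

/-- Expand the square around `x t - Z`: the preconditioner cancels in the linear term, and the
quadratic term is a dual norm, bounded by the leverage. -/
theorem step_le (h : IsOnlineNewton η lam s Y g T x) (hlam : 0 < lam) {t : ℕ}
    (ht : t ∈ Finset.Icc 1 T) {Z : E} (hZ : Z ∈ s) :
    inner ℝ (x (t + 1) - Z) (regGram lam Y t (x (t + 1) - Z)) ≤
      inner ℝ (x t - Z) (regGram lam Y t (x t - Z)) - 2 * η * inner ℝ (g t) (Y t (x t - Z))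
        + η ^ 2 * (‖g t‖ ^ 2 * leverage lam Y t) := by
  refine (h.step t ht Z hZ).trans ?_
  have hinv := regGram_isInvertible Y hlam t
  have hq := inner_inverse_adjoint_le_leverage Y hlam t (g t)
  set u := ContinuousLinearMap.adjoint (Y t) (g t) with hu
  set z := (regGram lam Y t).inverse u
  have hz : regGram lam Y t z = u := hinv.self_apply_inverse u
  have e : x t - η • z - Z = (x t - Z) - η • z := by abel
  have h1 : inner ℝ z (regGram lam Y t (x t - Z)) = inner ℝ u (x t - Z) := by
    rw [inner_regGram_symm, hz]
  have h2 : inner ℝ u (x t - Z) = inner ℝ (g t) (Y t (x t - Z)) := by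
    rw [hu, ContinuousLinearMap.adjoint_inner_left]
  rw [e, map_sub, map_smul, hz]
  generalize x t - Z = v at h1 h2 ⊢
  simp only [inner_sub_left, inner_sub_right, real_inner_smul_left, real_inner_smul_right]
  rw [h1, real_inner_comm u z, real_inner_comm u v, ← h2]
  linarith [mul_le_mul_of_nonneg_left hq (sq_nonneg η)]

theorem regret_le (h : IsOnlineNewton η lam s Y g T x) (hlam : 0 < lam) {α : ℝ} (hη : 0 < η)
    (hα : 1 ≤ η * α) {Z : E} (hZ : Z ∈ s) :
    ∑ t ∈ Finset.Icc 1 T, (inner ℝ (g t) (Y t (x t - Z)) - α / 2 * ‖Y t (x t - Z)‖ ^ 2) ≤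
      lam / (2 * η) * ‖x 1 - Z‖ ^ 2
        + η / 2 * ∑ t ∈ Finset.Icc 1 T, ‖g t‖ ^ 2 * leverage lam Y t := by
  -- Passing from `Λ_N` to `Λ_{N+1}` at `x (N + 1)` adds `‖Y_{N+1} (x_{N+1} - Z)‖²`, which the
  -- curvature term covers since `η α ≥ 1`. At `N = 0` the potential is `lam ‖x 1 - Z‖²`.
  have key : ∀ N ≤ T, 2 * η * ∑ t ∈ Finset.Icc 1 N,
        (inner ℝ (g t) (Y t (x t - Z)) - α / 2 * ‖Y t (x t - Z)‖ ^ 2)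
        + inner ℝ (x (N + 1) - Z) (regGram lam Y N (x (N + 1) - Z)) ≤
      lam * ‖x 1 - Z‖ ^ 2 + η ^ 2 * ∑ t ∈ Finset.Icc 1 N, ‖g t‖ ^ 2 * leverage lam Y t := by
    intro N
    induction N with
    | zero => intro _; rw [inner_regGram_self]; simp
    | succ N ih =>
      intro hN
      rw [Finset.sum_Icc_succ_top (Nat.le_add_left 1 N), Finset.sum_Icc_succ_top (Nat.le_add_left 1 N)]
      have h1 := ih (by omega)
      have h2 := h.step_le hlam (t := N + 1) (Finset.mem_Icc.2 ⟨by omega, hN⟩) hZ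
      have h3 : inner ℝ (x (N + 1) - Z) (regGram lam Y (N + 1) (x (N + 1) - Z)) =
          inner ℝ (x (N + 1) - Z) (regGram lam Y N (x (N + 1) - Z)) +
            ‖Y (N + 1) (x (N + 1) - Z)‖ ^ 2 := by
        simp only [inner_regGram_self, Finset.sum_Icc_succ_top (Nat.le_add_left 1 N), add_assoc]
      have h4 : ‖Y (N + 1) (x (N + 1) - Z)‖ ^ 2 ≤
          η * α * ‖Y (N + 1) (x (N + 1) - Z)‖ ^ 2 := le_mul_of_one_le_left (by positivity) hα
      linarith
  have h1 := key T le_rfl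
  have h2 := inner_regGram_self_nonneg Y hlam T (x (T + 1) - Z)
  have h3 : lam / (2 * η) * ‖x 1 - Z‖ ^ 2
        + η / 2 * ∑ t ∈ Finset.Icc 1 T, ‖g t‖ ^ 2 * leverage lam Y t =
      (lam * ‖x 1 - Z‖ ^ 2 + η ^ 2 * ∑ t ∈ Finset.Icc 1 T, ‖g t‖ ^ 2 * leverage lam Y t)
        / (2 * η) := by
    field_simp
  rw [h3, le_div_iff₀ (by positivity)]
  linarith

/-- The leverage of round `i` compares `‖Y_i ·‖` with the `Λ_i`-norm, which is at most the
`Λ_j`-norm, and in that norm the step at `j` has length at most `η G √q_j`. Finally `q_i q_j ≤ (q_i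
+ q_j)²`. -/
theorem norm_apply_step_le (h : IsOnlineNewton η lam s Y g T x) (hlam : 0 < lam) (hη : 0 < η)
    {G : ℝ} (hG : ∀ t ∈ Finset.Icc 1 T, ‖g t‖ ≤ G) {i j : ℕ} (hij : i ≤ j)
    (hj : j ∈ Finset.Icc 1 T) :
    ‖Y i (x (j + 1) - x j)‖ ≤ η * G * (leverage lam Y i + leverage lam Y j) := by
  have hG0 : 0 ≤ G := (norm_nonneg _).trans (hG j hj)
  have hqi := leverage_nonneg Y hlam i
  have hqj := leverage_nonneg Y hlam j
  refine le_of_sq_le_sq ?_ (by positivity)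
  have h1 := norm_sq_le_leverage Y hlam i (x (j + 1) - x j)
  have h2 := regGram_mono (lam := lam) Y i j hij (x (j + 1) - x j)
  -- With `Z = x j` only the quadratic term survives.
  have h3 := h.step_le hlam hj (h.mem j)
  simp only [sub_self, map_zero, inner_zero_right, mul_zero, zero_add] at h3
  have h4 : ‖g j‖ ^ 2 ≤ G ^ 2 := by gcongr; exact hG j hj
  calc _ ≤ leverage lam Y i * (η ^ 2 * (G ^ 2 * leverage lam Y j)) := by
        refine h1.trans ?_
        gcongr
        refine h2.trans (h3.trans ?_)
        gcongr
    _ = (η * G) ^ 2 * (leverage lam Y i * leverage lam Y j) := by ring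
    _ ≤ (η * G) ^ 2 * (leverage lam Y i + leverage lam Y j) ^ 2 := by
        gcongr
        nlinarith
    _ = _ := by ring

/-- The movement of the iterates over a window is controlled by the leverages in the window. -/
theorem norm_apply_sub_le (h : IsOnlineNewton η lam s Y g T x) (hlam : 0 < lam) (hη : 0 < η)
    {G : ℝ} (hG : ∀ t ∈ Finset.Icc 1 T, ‖g t‖ ≤ G) {i t : ℕ} (hi : 1 ≤ i) (hit : i ≤ t)
    (ht : t ≤ T) :
    ‖Y i (x i - x t)‖ ≤ η * G * ∑ j ∈ Finset.Ico i t, (leverage lam Y i + leverage lam Y j) := by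
  induction t, hit using Nat.le_induction with
  | base => simp
  | succ t hit ih =>
    rw [Finset.sum_Ico_succ_top hit, mul_add]
    have h1 := h.norm_apply_step_le hlam hη hG hit (Finset.mem_Icc.2 ⟨by omega, by omega⟩)
    have e : x i - x (t + 1) = (x i - x t) - (x (t + 1) - x t) := by abel
    rw [e, map_sub]
    exact (norm_sub_le _ _).trans (add_le_add (ih (by omega)) h1)

end IsOnlineNewton

end OnlineNewton

/-- After exchanging the sums, `s` is counted only for `t ∈ (s, s + H]`. Truncated subtraction lets
a window reach time `0`. -/
theorem Finset.sum_Icc_sum_Ico_sub_le {q : ℕ → ℝ} (hq : ∀ s, 0 ≤ q s) (H T : ℕ) :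
    ∑ t ∈ Finset.Icc 1 T, ∑ s ∈ Finset.Ico (t - H) t, q s ≤ H * ∑ s ∈ Finset.Icc 0 T, q s := by
  rw [Finset.sum_comm' (t' := Finset.Icc 0 T) (s' := fun s => (Finset.Icc 1 T).filter
      fun t => t - H ≤ s ∧ s < t), Finset.mul_sum]
  · refine Finset.sum_le_sum fun s _ => ?_
    rw [Finset.sum_const, nsmul_eq_mul]
    refine mul_le_mul_of_nonneg_right ?_ (hq s)
    have : ((Finset.Icc 1 T).filter fun t => t - H ≤ s ∧ s < t) ⊆ Finset.Ioc s (s + H) := by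
      intro t ht
      simp only [Finset.mem_filter, Finset.mem_Icc, Finset.mem_Ioc] at ht ⊢
      omega
    have := Finset.card_le_card this
    rw [Nat.card_Ioc] at this
    exact_mod_cast this.trans (by omega)
  · intro t s
    simp only [Finset.mem_filter, Finset.mem_Icc, Finset.mem_Ico]
    omega

/-! ### The parameter space and its constraint set. -/

namespace DRCParam

variable {n m H : ℕ}

theorem block_apply (M : DRCParam n m H) (i : Fin H) (v : Vec n) (a : Fin m) :
    M.block i v a = ∑ b, M (i, a, b) * v b := by
  simp [block, Matrix.toLpLin_apply, Matrix.mulVec, dotProduct]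

theorem norm_block_le (M : DRCParam n m H) (i : Fin H) : ‖M.block i‖ ≤ ‖M‖ := by
  refine ContinuousLinearMap.opNorm_le_bound _ (norm_nonneg _) fun v => ?_
  refine le_of_sq_le_sq ?_ (by positivity)
  rw [mul_pow, EuclideanSpace.real_norm_sq_eq, EuclideanSpace.real_norm_sq_eq,
    EuclideanSpace.real_norm_sq_eq]
  have h1 : ∑ a, ∑ b, M (i, a, b) ^ 2 ≤ ∑ p, M p ^ 2 := by
    rw [Fintype.sum_prod_type]
    simp only [Fintype.sum_prod_type]
    exact Finset.single_le_sum (f := fun i => ∑ a, ∑ b, M (i, a, b) ^ 2)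
      (fun _ _ => Finset.sum_nonneg fun _ _ => Finset.sum_nonneg fun _ _ => sq_nonneg _)
      (Finset.mem_univ i)
  calc ∑ a, (M.block i v) a ^ 2 ≤ ∑ a, (∑ b, M (i, a, b) ^ 2) * ∑ b, v b ^ 2 := by
        refine Finset.sum_le_sum fun a _ => ?_
        rw [block_apply]
        exact Finset.sum_mul_sq_le_sq_mul_sq _ _ _
    _ ≤ _ := by
        rw [← Finset.sum_mul]
        exact mul_le_mul_of_nonneg_right h1 (Finset.sum_nonneg fun _ _ => sq_nonneg _)

theorem abs_entry_le (M : DRCParam n m H) (i : Fin H) (a : Fin m) (b : Fin n) :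
    |M (i, a, b)| ≤ ‖M.block i‖ := by
  have h : M.block i (EuclideanSpace.single b 1) a = M (i, a, b) := by
    rw [block_apply]; simp
  rw [← h, ← Real.norm_eq_abs]
  refine (PiLp.norm_apply_le _ a).trans (((M.block i).le_opNorm _).trans ?_)
  simp

variable {γ : ℝ}

theorem norm_sq_le_of_mem {M : DRCParam n m H} (hM : M ∈ constraintSet n m H γ) :
    ‖M‖ ^ 2 ≤ H * (m * n) * γ ^ 2 := by
  rw [EuclideanSpace.real_norm_sq_eq]
  have : ∀ p, M p ^ 2 ≤ γ ^ 2 := fun ⟨i, a, b⟩ => by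
    rw [← sq_abs]
    have h1 : ‖M.block i‖ ≤ ∑ i, ‖M.block i‖ :=
      Finset.single_le_sum (f := fun i => ‖M.block i‖) (fun _ _ => norm_nonneg _)
        (Finset.mem_univ i)
    have h2 := M.abs_entry_le i a b
    have h3 : ∑ i, ‖M.block i‖ ≤ γ := hM
    gcongr
    linarith
  refine (Finset.sum_le_card_nsmul _ _ _ fun p _ => this p).trans (le_of_eq ?_)
  simp

theorem continuous_block (i : Fin H) : Continuous fun M : DRCParam n m H => M.block i := by
  let f : DRCParam n m H →ₗ[ℝ] (Vec n →L[ℝ] Vec m) :=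
    { toFun := fun M => M.block i
      map_add' := fun M N => block_add M N i
      map_smul' := fun r M => block_smul r M i }
  exact f.continuous_of_finiteDimensional

theorem convex_constraintSet : Convex ℝ (constraintSet n m H γ) := by
  intro M hM N hN a b ha hb hab
  have hM' : ∑ i, ‖M.block i‖ ≤ γ := hM
  have hN' : ∑ i, ‖N.block i‖ ≤ γ := hN
  change ∑ i, ‖(a • M + b • N).block i‖ ≤ γ
  calc ∑ i, ‖(a • M + b • N).block i‖ ≤ ∑ i, (a * ‖M.block i‖ + b * ‖N.block i‖) := by
        refine Finset.sum_le_sum fun i _ => ?_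
        rw [block_add, block_smul, block_smul]
        refine (norm_add_le _ _).trans (le_of_eq ?_)
        rw [norm_smul, norm_smul, Real.norm_of_nonneg ha, Real.norm_of_nonneg hb]
    _ = a * ∑ i, ‖M.block i‖ + b * ∑ i, ‖N.block i‖ := by
        rw [Finset.sum_add_distrib, Finset.mul_sum, Finset.mul_sum]
    _ ≤ a * γ + b * γ := by gcongr
    _ = γ := by rw [← add_mul, hab, one_mul]

theorem isCompact_constraintSet : IsCompact (constraintSet n m H γ) := by
  refine Metric.isCompact_of_isClosed_isBounded ?_ ?_
  · exact isClosed_le (continuous_finsetSum _ fun i _ => (continuous_block i).norm)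
      continuous_const
  · refine (Metric.isBounded_closedBall (x := (0 : DRCParam n m H))
      (r := Real.sqrt (H * (m * n) * γ ^ 2))).subset fun M hM => ?_
    rw [mem_closedBall_zero_iff]
    exact Real.le_sqrt_of_sq_le (norm_sq_le_of_mem hM)

end DRCParam

/-! ### Closed-loop trajectories and their bounds. -/

namespace LTVProblem

variable {n m : ℕ} (S : LTVProblem n m)

theorem eq_closedLoopProd_of_rec {y : ℕ → Vec n} {r : ℕ}
    (hy : ∀ t, r ≤ t → y (t + 1) = S.closedLoop t (y t)) (k : ℕ) :
    y (r + k) = S.closedLoopProd r k (y r) := by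
  induction k with
  | zero => simp [closedLoopProd]
  | succ k ih => rw [← add_assoc, hy _ (by omega), ih]; rfl

/-- Variation of constants. -/
theorem eq_sum_of_rec {y v : ℕ → Vec n} {r : ℕ} (h0 : y r = 0)
    (hy : ∀ t, r ≤ t → y (t + 1) = S.closedLoop t (y t) + v t) {t : ℕ} (hrt : r ≤ t) :
    y t = ∑ s ∈ Finset.Ico r t, S.closedLoopProd (s + 1) (t - 1 - s) (v s) := by
  induction t, hrt using Nat.le_induction with
  | base => simp [h0]
  | succ t hrt ih =>
    rw [Finset.sum_Ico_succ_top hrt, hy t hrt, ih, map_sum]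
    congr 1
    · refine Finset.sum_congr rfl fun s hs => ?_
      have hst := (Finset.mem_Ico.1 hs).2
      obtain ⟨k, rfl⟩ : ∃ k, t = s + 1 + k := ⟨t - (s + 1), by omega⟩
      have e1 : s + 1 + k - 1 - s = k := by omega
      have e2 : s + 1 + k + 1 - 1 - s = k + 1 := by omega
      rw [e1, e2]
      rfl
    · simp [closedLoopProd]

/-- The boundedness and stability assumptions on the dynamics over the horizon `T`. -/
structure IsStableOn (T : ℕ) (W κ δ C_B : ℝ) : Prop where
  δ_pos : 0 < δ
  δ_lt_one : δ < 1
  one_le : 1 ≤ T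
  norm_w_le : ∀ t ∈ Finset.Icc 0 T, ‖S.w t‖ ≤ W
  norm_B_le : ∀ t ∈ Finset.Icc 1 T, ‖S.B t‖ ≤ C_B
  norm_K_le : ∀ t ∈ Finset.Icc 1 T, ‖S.K t‖ ≤ κ
  stab : S.SeqStabilizing T κ δ

variable {H : ℕ}

theorem response_apply (t : ℕ) (M : DRCParam n m H) :
    S.response H t M = ∑ i : Fin H, M.block i (S.xnat (t - i)) := rfl

theorem response_zero (M : DRCParam n m H) : S.response H 0 M = 0 := by
  simp [response_apply, xnat]

theorem stateFrom_of_le (M : ℕ → DRCParam n m H) {r t : ℕ} (h : t ≤ r) :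
    S.stateFrom r M t = 0 := by
  cases t with
  | zero => rfl
  | succ t => exact if_pos h

theorem stateFrom_succ (M : ℕ → DRCParam n m H) {r t : ℕ} (h : r ≤ t) :
    S.stateFrom r M (t + 1) = S.closedLoop t (S.stateFrom r M t)
      + (S.B t (S.response H t (M t)) + S.w t) := by
  rw [stateFrom, if_neg (not_lt.2 h)]
  simp [closedLoop, control, add_assoc]

theorem stateLin_of_le {r t : ℕ} (h : t ≤ r) : S.stateLin H r t = 0 := by
  cases t with
  | zero => rfl
  | succ t => exact if_pos h

theorem stateLin_succ {r t : ℕ} (h : r ≤ t) (M : DRCParam n m H) :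
    S.stateLin H r (t + 1) M
      = S.closedLoop t (S.stateLin H r t M) + S.B t (S.response H t M) := by
  rw [stateLin, if_neg (not_lt.2 h)]
  rfl

theorem stateFrom_const (r t : ℕ) (M : DRCParam n m H) :
    S.stateFrom r (fun _ => M) t
      = S.stateFrom r (fun _ => (0 : DRCParam n m H)) t + S.stateLin H r t M := by
  induction t with
  | zero => simp [stateFrom, stateLin]
  | succ t ih =>
    rcases lt_or_ge t r with h | h
    · rw [S.stateFrom_of_le _ h, S.stateFrom_of_le _ h, S.stateLin_of_le h]; simp
    · rw [S.stateFrom_succ _ h, S.stateFrom_succ _ h, S.stateLin_succ h, ih]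
      simp only [map_add, map_zero]
      abel

namespace IsStableOn

variable {S} {T : ℕ} {W κ δ C_B γ : ℝ} (hS : S.IsStableOn T W κ δ C_B)

include hS

theorem W_nonneg : 0 ≤ W := (norm_nonneg _).trans (hS.norm_w_le 0 (by simp))

theorem C_B_nonneg : 0 ≤ C_B := (norm_nonneg _).trans (hS.norm_B_le 1 (by simpa using hS.one_le))

theorem κ_nonneg : 0 ≤ κ := (norm_nonneg _).trans (hS.norm_K_le 1 (by simpa using hS.one_le))

/-- The constant `1 + κ` also covers the empty product, about which the stability hypothesis says
nothing. -/
theorem norm_closedLoopProd_le {r k : ℕ} (hr : 1 ≤ r) (hrk : r + k ≤ T + 1) :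
    ‖S.closedLoopProd r k‖ ≤ (1 + κ) * (1 - δ) ^ k := by
  have h1 := hS.κ_nonneg
  have h2 := hS.δ_lt_one
  rcases Nat.eq_zero_or_pos k with rfl | hk
  · rw [closedLoopProd]
    refine ContinuousLinearMap.norm_id_le.trans ?_
    simp [h1]
  · refine (hS.stab r k hr hk hrk).le.trans ?_
    have : 0 ≤ (1 - δ) ^ k := pow_nonneg (by linarith) k
    nlinarith

theorem norm_le_sum_of_rec {y v : ℕ → Vec n} {r : ℕ} (h0 : y r = 0)
    (hy : ∀ t, r ≤ t → y (t + 1) = S.closedLoop t (y t) + v t) {t : ℕ} (hrt : r ≤ t)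
    (ht : t ≤ T + 1) :
    ‖y t‖ ≤ ∑ s ∈ Finset.Ico r t, (1 + κ) * (1 - δ) ^ (t - 1 - s) * ‖v s‖ := by
  rw [S.eq_sum_of_rec h0 hy hrt]
  refine norm_sum_le_of_le _ fun s hs => ?_
  have hst := (Finset.mem_Ico.1 hs).2
  refine (ContinuousLinearMap.le_opNorm _ _).trans ?_
  gcongr
  -- The products start at `s + 1 ≥ 1`, so the unconstrained matrices at time `0` never enter, even
  -- for `r = 0`.
  exact hS.norm_closedLoopProd_le (by omega) (by omega)

/-- Decay is discarded here: this form serves inputs whose sum over the window is already small. -/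
theorem norm_le_mul_sum_of_rec {y v : ℕ → Vec n} {r : ℕ} (h0 : y r = 0)
    (hy : ∀ t, r ≤ t → y (t + 1) = S.closedLoop t (y t) + v t) {t : ℕ} (hrt : r ≤ t)
    (ht : t ≤ T + 1) : ‖y t‖ ≤ (1 + κ) * ∑ s ∈ Finset.Ico r t, ‖v s‖ := by
  refine (hS.norm_le_sum_of_rec h0 hy hrt ht).trans ?_
  rw [Finset.mul_sum]
  have h1 := hS.κ_nonneg
  refine Finset.sum_le_sum fun s _ => mul_le_mul_of_nonneg_right ?_ (norm_nonneg _)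
  exact mul_le_of_le_one_right (by linarith)
    (pow_le_one₀ (by linarith [hS.δ_lt_one]) (by linarith [hS.δ_pos]))

theorem norm_le_of_rec {y v : ℕ → Vec n} {r : ℕ} (h0 : y r = 0)
    (hy : ∀ t, r ≤ t → y (t + 1) = S.closedLoop t (y t) + v t) {t : ℕ} (hrt : r ≤ t)
    (ht : t ≤ T + 1) {V : ℝ} (hV : 0 ≤ V) (hv : ∀ s < t, ‖v s‖ ≤ V) :
    ‖y t‖ ≤ (1 + κ) / δ * V := by
  have h1 := hS.κ_nonneg
  have h2 : 0 ≤ 1 - δ := by linarith [hS.δ_lt_one]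
  have h3 := hS.δ_pos
  have hgeom : ∑ s ∈ Finset.range t, (1 - δ) ^ (t - 1 - s) ≤ 1 / δ := by
    rw [Finset.sum_range_reflect (fun k => (1 - δ) ^ k) t]
    have := geom_sum_mul_neg (1 - δ) t
    rw [le_div_iff₀ h3]
    have h4 : 0 ≤ (1 - δ) ^ t := pow_nonneg h2 t
    rw [sub_sub_cancel] at this
    linarith
  calc ‖y t‖ ≤ ∑ s ∈ Finset.Ico r t, (1 + κ) * (1 - δ) ^ (t - 1 - s) * ‖v s‖ :=
        hS.norm_le_sum_of_rec h0 hy hrt ht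
    _ ≤ ∑ s ∈ Finset.Ico r t, (1 + κ) * (1 - δ) ^ (t - 1 - s) * V := by
        refine Finset.sum_le_sum fun s hs => ?_
        gcongr
        exact hv s (Finset.mem_Ico.1 hs).2
    _ ≤ ∑ s ∈ Finset.range t, (1 + κ) * (1 - δ) ^ (t - 1 - s) * V := by
        refine Finset.sum_le_sum_of_subset_of_nonneg (fun s hs => ?_) fun s _ _ => by positivity
        exact Finset.mem_range.2 (Finset.mem_Ico.1 hs).2
    _ = (1 + κ) * V * ∑ s ∈ Finset.range t, (1 - δ) ^ (t - 1 - s) := by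
        rw [Finset.mul_sum]
        exact Finset.sum_congr rfl fun _ _ => by ring
    _ ≤ (1 + κ) * V * (1 / δ) := by gcongr
    _ = _ := by ring

theorem norm_xnat_le {t : ℕ} (ht : t ≤ T + 1) : ‖S.xnat t‖ ≤ (1 + κ) / δ * W :=
  hS.norm_le_of_rec (y := S.xnat) (v := S.w) (r := 0) rfl (fun _ _ => rfl) (Nat.zero_le t) ht
    hS.W_nonneg fun s hs => hS.norm_w_le s (by simp; omega)

theorem natBound_nonneg : 0 ≤ (1 + κ) / δ * W := by
  have h1 := hS.κ_nonneg
  have h2 := hS.δ_pos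
  have h3 := hS.W_nonneg
  positivity

theorem norm_response_le {t : ℕ} (ht : t ≤ T + 1) (M : DRCParam n m H) :
    ‖S.response H t M‖ ≤ (∑ i, ‖M.block i‖) * ((1 + κ) / δ * W) := by
  rw [response_apply, Finset.sum_mul]
  refine norm_sum_le_of_le _ fun i _ => ?_
  refine (ContinuousLinearMap.le_opNorm _ _).trans ?_
  gcongr
  exact hS.norm_xnat_le (by omega)

theorem norm_response_le_of_mem {t : ℕ} (ht : t ≤ T + 1) {M : DRCParam n m H}
    (hM : M ∈ DRCParam.constraintSet n m H γ) :
    ‖S.response H t M‖ ≤ γ * ((1 + κ) / δ * W) := by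
  have hM' : ∑ i, ‖M.block i‖ ≤ γ := hM
  have := hS.natBound_nonneg
  refine (hS.norm_response_le ht M).trans ?_
  gcongr

theorem norm_response_le_norm {t : ℕ} (ht : t ≤ T + 1) (M : DRCParam n m H) :
    ‖S.response H t M‖ ≤ (1 + κ) / δ * W * H * ‖M‖ := by
  refine (hS.norm_response_le ht M).trans ?_
  have h1 : ∑ i, ‖M.block i‖ ≤ H * ‖M‖ := by
    refine (Finset.sum_le_sum fun i _ => M.norm_block_le i).trans (le_of_eq ?_)
    simp
  have := hS.natBound_nonneg
  calc _ ≤ H * ‖M‖ * ((1 + κ) / δ * W) := by gcongr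
    _ = _ := by ring

theorem norm_B_response_le {t : ℕ} (ht : t ≤ T) (M : DRCParam n m H) :
    ‖S.B t (S.response H t M)‖ ≤ C_B * ‖S.response H t M‖ := by
  -- At time `0` the response vanishes, so no bound on `B 0` is needed.
  rcases Nat.eq_zero_or_pos t with rfl | h
  · simp [response_zero]
  · exact ContinuousLinearMap.le_of_opNorm_le _ (hS.norm_B_le t (by simp; omega)) _

theorem norm_stateFrom_le {M : ℕ → DRCParam n m H}
    (hM : ∀ t, M t ∈ DRCParam.constraintSet n m H γ) (r : ℕ) {t : ℕ} (ht : t ≤ T + 1) :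
    ‖S.stateFrom r M t‖ ≤ (1 + κ) / δ * (C_B * (γ * ((1 + κ) / δ * W)) + W) := by
  have hγ : 0 ≤ γ := (Finset.sum_nonneg fun _ _ => norm_nonneg _).trans (hM 0)
  have h1 := hS.κ_nonneg
  have h2 := hS.δ_pos
  have h3 := hS.W_nonneg
  have h4 := hS.C_B_nonneg
  rcases le_total t r with h | h
  · rw [S.stateFrom_of_le _ h, norm_zero]
    positivity
  · refine hS.norm_le_of_rec (S.stateFrom_of_le M le_rfl) (fun t ht => S.stateFrom_succ M ht) h ht
      (by positivity) fun s hs => ?_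
    refine (norm_add_le _ _).trans (add_le_add ?_ (hS.norm_w_le s (by simp; omega)))
    refine (hS.norm_B_response_le (by omega) _).trans ?_
    gcongr
    exact hS.norm_response_le_of_mem (by omega) (hM s)

theorem norm_stateLin_le (r : ℕ) {t : ℕ} (ht : t ≤ T + 1) (M : DRCParam n m H) :
    ‖S.stateLin H r t M‖ ≤ (1 + κ) / δ * (C_B * ((1 + κ) / δ * W * H * ‖M‖)) := by
  have h1 := hS.κ_nonneg
  have h2 := hS.δ_pos
  have h3 := hS.W_nonneg
  have h4 := hS.C_B_nonneg
  rcases le_total t r with h | h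
  · rw [S.stateLin_of_le h, zero_apply, norm_zero]
    positivity
  · refine hS.norm_le_of_rec (y := fun t => S.stateLin H r t M)
      (v := fun t => S.B t (S.response H t M)) (r := r) (by simp [S.stateLin_of_le le_rfl])
      (fun t ht => S.stateLin_succ ht M) h ht (by positivity) fun s hs => ?_
    refine (hS.norm_B_response_le (by omega) _).trans ?_
    gcongr
    exact hS.norm_response_le_norm (by omega) M

end IsStableOn

end LTVProblem

/-! ### Surrogate losses and their gradients. -/

namespace LTVProblem

variable {n m : ℕ} (S : LTVProblem n m) {H : ℕ}

theorem norm_toLp_prod_le (x : Vec n) (u : Vec m) :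
    ‖(WithLp.toLp 2 (x, u) : StateControl n m)‖ ≤ ‖x‖ + ‖u‖ := by
  refine le_of_sq_le_sq ?_ (by positivity)
  rw [WithLp.prod_norm_sq_eq_of_L2]
  change ‖x‖ ^ 2 + ‖u‖ ^ 2 ≤ _
  nlinarith [norm_nonneg x, norm_nonneg u]

/-- The pair of the state `x` and the control at time `t` with parameter `M`. -/
noncomputable def pairAt (t : ℕ) (x : Vec n) (M : DRCParam n m H) : StateControl n m :=
  WithLp.toLp 2 (x, S.control t x M)

theorem pairAt_sub (t : ℕ) (x y : Vec n) (M : DRCParam n m H) :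
    S.pairAt t x M - S.pairAt t y M = WithLp.toLp 2 (x - y, S.K t (x - y)) := by
  rw [pairAt, pairAt, ← WithLp.toLp_sub, Prod.mk_sub_mk, control, control, map_sub,
    add_sub_add_right_eq_sub]

theorem proxyLin_apply (t : ℕ) (M : DRCParam n m H) :
    S.proxyLin H t M = WithLp.toLp 2 (S.stateLin H (t - H) t M,
      S.K t (S.stateLin H (t - H) t M) + S.response H t M) := rfl

theorem proxyLin_zero : S.proxyLin H 0 = 0 := by
  ext1 M
  rw [proxyLin_apply, S.stateLin_of_le (Nat.zero_le _), response_zero]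
  simp

theorem pairAt_proxyState_const (t : ℕ) (M : DRCParam n m H) :
    S.pairAt t (S.proxyState (fun _ => M) t) M =
      S.pairAt t (S.proxyState (fun _ => (0 : DRCParam n m H)) t) (0 : DRCParam n m H)
        + S.proxyLin H t M := by
  rw [proxyLin_apply, pairAt, pairAt, ← WithLp.toLp_add, Prod.mk_add_mk, proxyState,
    S.stateFrom_const]
  simp only [control, map_add, map_zero, add_zero, proxyState]
  abel_nf

theorem surrogateLoss_eq (t : ℕ) (M : DRCParam n m H) :
    S.surrogateLoss t M = S.c t (S.pairAt t (S.proxyState (fun _ => M) t) M) := rfl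

/-- The gradient of the cost at the point at which `surrogateLoss t M` evaluates it. -/
noncomputable def proxyGradient (t : ℕ) (M : DRCParam n m H) : StateControl n m :=
  gradient (S.c t) (S.pairAt t (S.proxyState (fun _ => M) t) M)

/-- Chain rule along the affine map with linear part `Y_t`: the gradients have the form `Y_tᵀ g_t`
required by `IsOnlineNewton`. -/
theorem gradient_surrogateLoss {t : ℕ} (hc : Differentiable ℝ (S.c t)) (M : DRCParam n m H) :
    gradient (S.surrogateLoss t) M
      = ContinuousLinearMap.adjoint (S.proxyLin H t) (S.proxyGradient t M) := by
  apply HasGradientAt.gradient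
  rw [hasGradientAt_iff_hasFDerivAt]
  have h1 : HasFDerivAt (fun M : DRCParam n m H =>
      S.pairAt t (S.proxyState (fun _ => M) t) M) (S.proxyLin H t) M :=
    ((S.proxyLin H t).hasFDerivAt.const_add _).congr_of_eventuallyEq
      (Filter.Eventually.of_forall fun M => S.pairAt_proxyState_const t M)
  have h2 : HasFDerivAt (S.surrogateLoss t) _ M := HasFDerivAt.comp (g := S.c t)
    (f := fun M : DRCParam n m H => S.pairAt t (S.proxyState (fun _ => M) t) M) M
    (hc (S.pairAt t (S.proxyState (fun _ => M) t) M)).hasFDerivAt h1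
  refine h2.congr_fderiv ?_
  ext N
  simp only [ContinuousLinearMap.comp_apply, InnerProductSpace.toDual_apply_apply,
    ContinuousLinearMap.adjoint_inner_left, proxyGradient, inner_gradient_left]

/-- The assumptions on the stage costs over the horizon `T`. -/
structure HasRegularCosts (T : ℕ) (α L : ℝ) : Prop where
  α_pos : 0 < α
  differentiable : ∀ t ∈ Finset.Icc 1 T, Differentiable ℝ (S.c t)
  strongConvex : ∀ t ∈ Finset.Icc 1 T, StrongConvexOn Set.univ α (S.c t)
  norm_gradient_le : ∀ t ∈ Finset.Icc 1 T, ∀ (x : Vec n) (u : Vec m),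
    ‖gradient (S.c t) (WithLp.toLp 2 (x, u))‖ ≤ L * max 1 (‖x‖ + ‖u‖)

/-- A bound on all states reached with parameters from the constraint set. -/
noncomputable def stateBound (W κ δ C_B γ : ℝ) : ℝ :=
  (1 + κ) / δ * (C_B * (γ * ((1 + κ) / δ * W)) + W)

/-- A bound on the gradients of the costs along trajectories of disturbance response controls. -/
noncomputable def gradBound (W κ δ C_B γ L : ℝ) : ℝ :=
  L * max 1 (stateBound W κ δ C_B γ
    + (κ * stateBound W κ δ C_B γ + γ * ((1 + κ) / δ * W)))

/-- A bound on `‖proxyLin H t‖ / H`. -/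
noncomputable def linBound (W κ δ C_B : ℝ) : ℝ :=
  (1 + κ) * ((1 + κ) / δ * (C_B * ((1 + κ) / δ * W))) + (1 + κ) / δ * W

/-! ### Truncation, stability gap and surrogate regret of DRC-ONS. -/

section Bounds

variable {S} {T : ℕ} {W κ δ C_B γ α L η lam : ℝ} (hS : S.IsStableOn T W κ δ C_B)

include hS

theorem IsStableOn.norm_proxyLin_le {t : ℕ} (ht : t ∈ Finset.Icc 1 T) (M : DRCParam n m H) :
    ‖S.proxyLin H t M‖ ≤ linBound W κ δ C_B * H * ‖M‖ := by
  have h1 := hS.κ_nonneg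
  have htT : t ≤ T + 1 := by simp at ht; omega
  have hx := hS.norm_stateLin_le (t - H) htT M
  have hu := hS.norm_response_le_norm htT M
  rw [proxyLin_apply]
  refine (norm_toLp_prod_le _ _).trans ?_
  have hk := ContinuousLinearMap.le_of_opNorm_le _ (hS.norm_K_le t ht)
    (S.stateLin H (t - H) t M)
  have h2 := norm_add_le (S.K t (S.stateLin H (t - H) t M)) (S.response H t M)
  calc _ ≤ (1 + κ) * ‖S.stateLin H (t - H) t M‖ + ‖S.response H t M‖ := by linarith
    _ ≤ (1 + κ) * ((1 + κ) / δ * (C_B * ((1 + κ) / δ * W * H * ‖M‖)))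
        + (1 + κ) / δ * W * H * ‖M‖ := by gcongr
    _ = _ := by rw [linBound]; ring

/-- The response is the control component of `Y_t M` minus `K_t` times its state component. Hence
movement measured by `Y_t` controls the actual change of the input. -/
theorem IsStableOn.norm_response_le_proxyLin {t : ℕ} (ht : t ∈ Finset.Icc 1 T)
    (M : DRCParam n m H) : ‖S.response H t M‖ ≤ (1 + κ) * ‖S.proxyLin H t M‖ := by
  have h1 := hS.κ_nonneg
  have hx : ‖S.stateLin H (t - H) t M‖ ≤ ‖S.proxyLin H t M‖ :=
    WithLp.norm_fst_le _ (S.proxyLin H t M)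
  have hu : ‖S.K t (S.stateLin H (t - H) t M) + S.response H t M‖ ≤ ‖S.proxyLin H t M‖ :=
    WithLp.norm_snd_le _ (S.proxyLin H t M)
  have hk := ContinuousLinearMap.le_of_opNorm_le _ (hS.norm_K_le t ht)
    (S.stateLin H (t - H) t M)
  have e : S.response H t M = (S.K t (S.stateLin H (t - H) t M) + S.response H t M)
      - S.K t (S.stateLin H (t - H) t M) := by abel
  have h2 := norm_sub_le (S.K t (S.stateLin H (t - H) t M) + S.response H t M)
    (S.K t (S.stateLin H (t - H) t M))
  rw [← e] at h2
  nlinarith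

theorem IsStableOn.stateBound_nonneg (hγ : 0 ≤ γ) : 0 ≤ stateBound W κ δ C_B γ := by
  have h1 := hS.κ_nonneg
  have h2 := hS.δ_pos
  have h3 := hS.W_nonneg
  have h4 := hS.C_B_nonneg
  unfold stateBound
  positivity

variable (hc : S.HasRegularCosts T α L)

include hc

theorem HasRegularCosts.L_nonneg : 0 ≤ L := by
  have h := (norm_nonneg _).trans (hc.norm_gradient_le 1 (by simpa using hS.one_le) 0 0)
  exact nonneg_of_mul_nonneg_left h (lt_max_of_lt_left one_pos)

theorem HasRegularCosts.gradBound_nonneg : 0 ≤ gradBound W κ δ C_B γ L :=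
  mul_nonneg (hc.L_nonneg hS) (le_max_of_le_left zero_le_one)

theorem HasRegularCosts.norm_gradient_pairAt_le {t : ℕ} (ht : t ∈ Finset.Icc 1 T) {x : Vec n}
    (hx : ‖x‖ ≤ stateBound W κ δ C_B γ) {M : DRCParam n m H}
    (hM : M ∈ DRCParam.constraintSet n m H γ) :
    ‖gradient (S.c t) (S.pairAt t x M)‖ ≤ gradBound W κ δ C_B γ L := by
  have h1 := hS.κ_nonneg
  refine (hc.norm_gradient_le t ht x _).trans ?_
  refine mul_le_mul_of_nonneg_left (max_le_max le_rfl ?_) (hc.L_nonneg hS)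
  refine add_le_add hx ((norm_add_le _ _).trans (add_le_add ?_ ?_))
  · refine (ContinuousLinearMap.le_of_opNorm_le _ (hS.norm_K_le t ht) x).trans ?_
    gcongr
  · exact hS.norm_response_le_of_mem (by simp at ht; omega) hM

/-- Convexity bounds the difference by the gradient at the first point alone, so `y` needs no bound.
-/
theorem HasRegularCosts.cost_sub_le {t : ℕ} (ht : t ∈ Finset.Icc 1 T) {x y : Vec n}
    (hx : ‖x‖ ≤ stateBound W κ δ C_B γ) {M : DRCParam n m H}
    (hM : M ∈ DRCParam.constraintSet n m H γ) :
    S.c t (S.pairAt t x M) - S.c t (S.pairAt t y M)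
      ≤ gradBound W κ δ C_B γ L * ((1 + κ) * ‖x - y‖) := by
  have hα := hc.α_pos
  have h := (hc.strongConvex t ht).add_inner_gradient_le (hc.differentiable t ht (S.pairAt t x M))
    (S.pairAt t y M)
  have h1 := (abs_le.1 (abs_real_inner_le_norm (gradient (S.c t) (S.pairAt t x M))
    (S.pairAt t y M - S.pairAt t x M))).1
  have h2 := hc.norm_gradient_pairAt_le hS ht hx hM
  have h3 : ‖S.pairAt t y M - S.pairAt t x M‖ ≤ (1 + κ) * ‖x - y‖ := by
    rw [S.pairAt_sub, norm_sub_rev x y]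
    refine (norm_toLp_prod_le _ _).trans ?_
    linarith [ContinuousLinearMap.le_of_opNorm_le _ (hS.norm_K_le t ht) (y - x)]
  have h4 : ‖gradient (S.c t) (S.pairAt t x M)‖ * ‖S.pairAt t y M - S.pairAt t x M‖
      ≤ gradBound W κ δ C_B γ L * ((1 + κ) * ‖x - y‖) := by
    have := hc.gradBound_nonneg hS (γ := γ)
    gcongr
  have h5 : 0 ≤ α / 2 * ‖S.pairAt t y M - S.pairAt t x M‖ ^ 2 := by positivity
  linarith

theorem HasRegularCosts.abs_cost_sub_le {t : ℕ} (ht : t ∈ Finset.Icc 1 T) {x y : Vec n}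
    (hx : ‖x‖ ≤ stateBound W κ δ C_B γ) (hy : ‖y‖ ≤ stateBound W κ δ C_B γ)
    {M : DRCParam n m H} (hM : M ∈ DRCParam.constraintSet n m H γ) :
    |S.c t (S.pairAt t x M) - S.c t (S.pairAt t y M)|
      ≤ gradBound W κ δ C_B γ L * ((1 + κ) * ‖x - y‖) := by
  rw [abs_le]
  have h1 := hc.cost_sub_le hS ht hx hM (y := y)
  have h2 := hc.cost_sub_le hS ht hy hM (y := x)
  rw [norm_sub_rev] at h2
  constructor <;> linarith

/-- Truncating the history of the state to `H` rounds costs little in total. -/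
theorem HasRegularCosts.sum_abs_cost_sub_memoryLoss_le (hH : Real.log T ≤ δ * H)
    {M : ℕ → DRCParam n m H} (hM : ∀ t, M t ∈ DRCParam.constraintSet n m H γ) :
    ∑ t ∈ Finset.Icc 1 T, |S.cost M t - S.memoryLoss M t| ≤
      gradBound W κ δ C_B γ L * ((1 + κ) * ((1 + κ) * stateBound W κ δ C_B γ)) := by
  have hγ : 0 ≤ γ := (Finset.sum_nonneg fun _ _ => norm_nonneg _).trans (hM 0)
  have hκ := hS.κ_nonneg
  have hX := hS.stateBound_nonneg hγ
  have hG := hc.gradBound_nonneg hS (γ := γ)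
  have hT : (0 : ℝ) < T := by exact_mod_cast hS.one_le
  have hpow : (1 - δ) ^ H ≤ 1 / T := by
    calc (1 - δ) ^ H ≤ Real.exp (-δ) ^ H := by
          have := hS.δ_lt_one
          exact pow_le_pow_left₀ (by linarith) (Real.one_sub_le_exp_neg δ) H
      _ = Real.exp (-(δ * H)) := by rw [← Real.exp_nat_mul]; ring_nf
      _ ≤ Real.exp (-Real.log T) := by gcongr
      _ = 1 / T := by rw [Real.exp_neg, Real.exp_log hT, one_div]
  have key : ∀ t ∈ Finset.Icc 1 T, |S.cost M t - S.memoryLoss M t| ≤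
      gradBound W κ δ C_B γ L * ((1 + κ) * ((1 + κ) * stateBound W κ δ C_B γ)) * (1 / T) := by
    intro t ht
    have htT : t ≤ T + 1 := by simp at ht; omega
    have h0 := hc.abs_cost_sub_le hS ht (hS.norm_stateFrom_le hM 0 htT)
      (hS.norm_stateFrom_le hM (t - H) htT) (hM t)
    refine h0.trans ?_
    have hd : ‖S.stateFrom 0 M t - S.stateFrom (t - H) M t‖
        ≤ (1 + κ) * (1 / T) * stateBound W κ δ C_B γ := by
      rcases le_or_gt t H with h | h
      · rw [Nat.sub_eq_zero_of_le h, sub_self, norm_zero]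
        positivity
      -- From time `t - H` on, both states receive the same inputs, so their difference obeys the
      -- homogeneous closed loop and contracts for `H` rounds.
      · have hrec := S.eq_closedLoopProd_of_rec (r := t - H)
          (y := fun s => S.stateFrom 0 M s - S.stateFrom (t - H) M s)
          (fun s hs => by
            rw [S.stateFrom_succ M hs, S.stateFrom_succ M (Nat.zero_le s), map_sub]
            abel) H
        simp only [Nat.sub_add_cancel h.le, S.stateFrom_of_le M (le_refl (t - H)), sub_zero]
          at hrec
        rw [hrec]
        refine (ContinuousLinearMap.le_opNorm _ _).trans ?_
        have h1 := hS.norm_closedLoopProd_le (r := t - H) (k := H) (by omega) (by omega)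
        have h2 : ‖S.stateFrom 0 M (t - H)‖ ≤ stateBound W κ δ C_B γ :=
          hS.norm_stateFrom_le hM 0 (by omega)
        gcongr
        exact h1.trans (by gcongr)
    calc _ ≤ gradBound W κ δ C_B γ L
          * ((1 + κ) * ((1 + κ) * (1 / T) * stateBound W κ δ C_B γ)) := by gcongr
      _ = _ := by ring
  refine (Finset.sum_le_card_nsmul _ _ _ key).trans (le_of_eq ?_)
  rw [Nat.card_Icc, add_tsub_cancel_right, nsmul_eq_mul]
  field_simp

omit hS in
-- Strong convexity of `c_t` pulled back along `Y_t`: the surrogate is curved only in the seminorm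
-- `‖Y_t ·‖`, which is what `regret_le` uses.
theorem HasRegularCosts.surrogateLoss_sub_le {t : ℕ} (ht : t ∈ Finset.Icc 1 T)
    (M N : DRCParam n m H) :
    S.surrogateLoss t M - S.surrogateLoss t N ≤
      inner ℝ (S.proxyGradient t M) (S.proxyLin H t (M - N))
        - α / 2 * ‖S.proxyLin H t (M - N)‖ ^ 2 := by
  have h := (hc.strongConvex t ht).add_inner_gradient_le
    (hc.differentiable t ht (S.pairAt t (S.proxyState (fun _ => M) t) M))
    (S.pairAt t (S.proxyState (fun _ => N) t) N)
  have e : S.pairAt t (S.proxyState (fun _ => N) t) N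
      - S.pairAt t (S.proxyState (fun _ => M) t) M = -S.proxyLin H t (M - N) := by
    rw [S.pairAt_proxyState_const t M, S.pairAt_proxyState_const t N, map_sub]
    abel
  rw [e, inner_neg_right, norm_neg] at h
  rw [surrogateLoss_eq, surrogateLoss_eq, proxyGradient]
  linarith

omit hS in
-- The constraint set is compact and contains `M₁`, so the `epsilon` in `semiONS` picks a genuine
-- minimizer; convexity makes that projection nonexpansive.
theorem HasRegularCosts.isOnlineNewton_drcONS (hlam : 0 < lam) {M₁ : DRCParam n m H}
    (hM₁ : M₁ ∈ DRCParam.constraintSet n m H γ) :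
    IsOnlineNewton η lam (DRCParam.constraintSet n m H γ) (S.proxyLin H)
      (fun t => S.proxyGradient t (S.drcONS γ η lam M₁ t)) T (S.drcONS γ η lam M₁) := by
  have hspec : ∀ (t : ℕ) (M : DRCParam n m H), S.semiONS γ η lam t M ∈
      DRCParam.constraintSet n m H γ ∧
      IsMinOn (fun Z => inner ℝ (Z - S.newtonPoint η lam t M)
        (S.precond H lam t (Z - S.newtonPoint η lam t M)))
      (DRCParam.constraintSet n m H γ) (S.semiONS γ η lam t M) := fun t M => by
    refine Classical.epsilon_spec (p := fun N : DRCParam n m H =>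
      N ∈ DRCParam.constraintSet n m H γ ∧
      IsMinOn (fun Z => inner ℝ (Z - S.newtonPoint η lam t M)
        (S.precond H lam t (Z - S.newtonPoint η lam t M)))
      (DRCParam.constraintSet n m H γ) N) ?_
    exact DRCParam.isCompact_constraintSet.exists_isMinOn ⟨M₁, hM₁⟩
      (Continuous.continuousOn (by fun_prop))
  refine ⟨fun t => ?_, fun t ht Z hZ => ?_⟩
  · rcases t with _ | t
    · exact hM₁
    · rw [drcONS]
      split_ifs
      · exact hM₁
      · exact (hspec _ _).1
  · have h1 : t ≠ 0 := by simp at ht; omega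
    rw [← S.gradient_surrogateLoss (hc.differentiable t ht)]
    have h := hspec t (S.drcONS γ η lam M₁ t)
    rw [drcONS, if_neg h1]
    exact IsMinOn.inner_sub_le_of_convex (inner_regGram_symm (S.proxyLin H) t)
      (inner_regGram_self_nonneg (S.proxyLin H) hlam t) DRCParam.convex_constraintSet h.1 h.2 hZ

theorem HasRegularCosts.norm_proxyGradient_le {t : ℕ} (ht : t ∈ Finset.Icc 1 T)
    {M : DRCParam n m H} (hM : M ∈ DRCParam.constraintSet n m H γ) :
    ‖S.proxyGradient t M‖ ≤ gradBound W κ δ C_B γ L :=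
  hc.norm_gradient_pairAt_le hS ht
    (hS.norm_stateFrom_le (fun _ => hM) (t - H) (by simp at ht; omega)) hM

/-- Both proxy states start at `0` at time `t - H` under the same disturbances. Their difference is
driven only by `B_s` applied to the response to `M_s - M_t`, which `Y_s (M_s - M_t)` and thus the
leverages in the window control. -/
theorem HasRegularCosts.abs_memoryLoss_sub_surrogateLoss_le (hlam : 0 < lam) (hη : 0 < η)
    {M₁ : DRCParam n m H} (hM₁ : M₁ ∈ DRCParam.constraintSet n m H γ) {t : ℕ}
    (ht : t ∈ Finset.Icc 1 T) :
    |S.memoryLoss (S.drcONS γ η lam M₁) t - S.surrogateLoss t (S.drcONS γ η lam M₁ t)| ≤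
      2 * η * C_B * (1 + κ) ^ 3 * gradBound W κ δ C_B γ L ^ 2 * H
        * ∑ s ∈ Finset.Ico (t - H) t, leverage lam (S.proxyLin H) s := by
  have hκ := hS.κ_nonneg
  have hB := hS.C_B_nonneg
  have hG := hc.gradBound_nonneg hS (γ := γ)
  have hONS := hc.isOnlineNewton_drcONS (η := η) hlam hM₁
  set M := S.drcONS γ η lam M₁
  set G := gradBound W κ δ C_B γ L
  set q := leverage lam (S.proxyLin H)
  have hq : ∀ s, 0 ≤ q s := leverage_nonneg _ hlam
  have htT : t ≤ T := (Finset.mem_Icc.1 ht).2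
  have hcard : ((Finset.Ico (t - H) t).card : ℝ) ≤ H := by
    rw [Nat.card_Ico]
    exact_mod_cast (by omega : t - (t - H) ≤ H)
  have hterm : ∀ s ∈ Finset.Ico (t - H) t, ‖S.B s (S.response H s (M s - M t))‖ ≤
      C_B * ((1 + κ) * (η * G * ∑ j ∈ Finset.Ico (t - H) t, (q s + q j))) := by
    intro s hs
    obtain ⟨hs1, hs2⟩ := Finset.mem_Ico.1 hs
    have hsum : 0 ≤ ∑ j ∈ Finset.Ico (t - H) t, (q s + q j) :=
      Finset.sum_nonneg fun j _ => add_nonneg (hq s) (hq j)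
    rcases Nat.eq_zero_or_pos s with rfl | hpos
    · rw [response_zero, map_zero, norm_zero]
      positivity
    · refine (hS.norm_B_response_le (by omega) _).trans ?_
      refine mul_le_mul_of_nonneg_left ?_ hB
      refine (hS.norm_response_le_proxyLin (Finset.mem_Icc.2 ⟨hpos, by omega⟩) _).trans ?_
      refine mul_le_mul_of_nonneg_left ?_ (by positivity)
      refine (hONS.norm_apply_sub_le hlam hη
        (fun t ht => hc.norm_proxyGradient_le hS ht (hONS.mem t)) hpos hs2.le htT).trans ?_
      refine mul_le_mul_of_nonneg_left ?_ (by positivity)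
      exact Finset.sum_le_sum_of_subset_of_nonneg (Finset.Ico_subset_Ico_left hs1)
        fun j _ _ => add_nonneg (hq s) (hq j)
  have hd : ‖S.stateFrom (t - H) M t - S.stateFrom (t - H) (fun _ => M t) t‖ ≤
      (1 + κ) * ∑ s ∈ Finset.Ico (t - H) t, ‖S.B s (S.response H s (M s - M t))‖ := by
    refine hS.norm_le_mul_sum_of_rec (r := t - H)
      (y := fun s => S.stateFrom (t - H) M s - S.stateFrom (t - H) (fun _ => M t) s)
      (v := fun s => S.B s (S.response H s (M s - M t))) ?_ (fun s hs => ?_) (by omega) (by omega)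
    · simp only [S.stateFrom_of_le _ (le_refl (t - H)), sub_self]
    · simp only [S.stateFrom_succ _ hs, map_sub]
      abel
  have hsum : ∑ s ∈ Finset.Ico (t - H) t, ∑ j ∈ Finset.Ico (t - H) t, (q s + q j)
      ≤ 2 * H * ∑ s ∈ Finset.Ico (t - H) t, q s := by
    simp only [Finset.sum_add_distrib, Finset.sum_const, nsmul_eq_mul, ← Finset.mul_sum]
    have := mul_le_mul_of_nonneg_right hcard (Finset.sum_nonneg fun s (_ : s ∈ Finset.Ico (t - H) t)
      => hq s)
    linarith
  have h0 := hc.abs_cost_sub_le hS ht (hS.norm_stateFrom_le hONS.mem (t - H) (by omega : t ≤ T + 1))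
      (hS.norm_stateFrom_le (fun _ => hONS.mem t) (t - H) (by omega : t ≤ T + 1)) (hONS.mem t)
  refine h0.trans ?_
  calc _ ≤ G * ((1 + κ) * ((1 + κ) * ∑ s ∈ Finset.Ico (t - H) t,
        C_B * ((1 + κ) * (η * G * ∑ j ∈ Finset.Ico (t - H) t, (q s + q j))))) := by
        gcongr
        refine hd.trans ?_
        gcongr with s hs
        exact hterm s hs
    _ = G * ((1 + κ) * ((1 + κ) * (C_B * ((1 + κ) * (η * G * ∑ s ∈ Finset.Ico (t - H) t,
        ∑ j ∈ Finset.Ico (t - H) t, (q s + q j)))))) := by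
        simp only [Finset.mul_sum]
    _ ≤ G * ((1 + κ) * ((1 + κ) * (C_B * ((1 + κ) * (η * G *
        (2 * H * ∑ s ∈ Finset.Ico (t - H) t, q s)))))) := by gcongr
    _ = _ := by ring

theorem HasRegularCosts.stabilityGap_drcONS_le (hlam : 0 < lam) (hη : 0 < η)
    {M₁ : DRCParam n m H} (hM₁ : M₁ ∈ DRCParam.constraintSet n m H γ) :
    S.stabilityGap T (S.drcONS γ η lam M₁) ≤
      2 * η * C_B * (1 + κ) ^ 3 * gradBound W κ δ C_B γ L ^ 2 * H ^ 2
        * ∑ s ∈ Finset.Icc 1 T, leverage lam (S.proxyLin H) s := by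
  have hκ := hS.κ_nonneg
  have hB := hS.C_B_nonneg
  refine (Finset.sum_le_sum fun t ht =>
    hc.abs_memoryLoss_sub_surrogateLoss_le hS hlam hη hM₁ ht).trans ?_
  rw [← Finset.mul_sum]
  -- Since `Y_0 = 0`, windows reaching time `0` contribute nothing extra.
  have h0 : leverage lam (S.proxyLin H) 0 = 0 := by
    simp [leverage, proxyLin_zero]
  have h1 := Finset.sum_Icc_sum_Ico_sub_le (leverage_nonneg (S.proxyLin H) hlam) H T
  have h2 : ∑ s ∈ Finset.Icc 0 T, leverage lam (S.proxyLin H) s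
      = ∑ s ∈ Finset.Icc 1 T, leverage lam (S.proxyLin H) s := by
    rw [← Finset.add_sum_Ioc_eq_sum_Icc (Nat.zero_le T), h0, zero_add]
    rfl
  rw [h2] at h1
  calc _ ≤ 2 * η * C_B * (1 + κ) ^ 3 * gradBound W κ δ C_B γ L ^ 2 * H *
        (H * ∑ s ∈ Finset.Icc 1 T, leverage lam (S.proxyLin H) s) := by gcongr
    _ = _ := by ring

theorem HasRegularCosts.sum_surrogateLoss_sub_le (hlam : 0 < lam) (hη : 0 < η) (hα : 1 ≤ η * α)
    {M₁ M : DRCParam n m H} (hM₁ : M₁ ∈ DRCParam.constraintSet n m H γ)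
    (hM : M ∈ DRCParam.constraintSet n m H γ) :
    ∑ t ∈ Finset.Icc 1 T, (S.surrogateLoss t (S.drcONS γ η lam M₁ t) - S.surrogateLoss t M) ≤
      lam / (2 * η) * (4 * (H * (m * n) * γ ^ 2)) + η / 2 * (gradBound W κ δ C_B γ L ^ 2
        * ∑ s ∈ Finset.Icc 1 T, leverage lam (S.proxyLin H) s) := by
  have hONS := hc.isOnlineNewton_drcONS (η := η) hlam hM₁
  refine (Finset.sum_le_sum fun t ht => hc.surrogateLoss_sub_le ht _ M).trans
    ((hONS.regret_le hlam hη hα hM).trans ?_)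
  have h1 : S.drcONS γ η lam M₁ 1 = M₁ := if_pos rfl
  have h2 : ‖M₁ - M‖ ^ 2 ≤ 4 * (H * (m * n) * γ ^ 2) := by
    have := DRCParam.norm_sq_le_of_mem hM₁
    have := DRCParam.norm_sq_le_of_mem hM
    have h3 : ‖M₁ - M‖ ^ 2 ≤ (‖M₁‖ + ‖M‖) ^ 2 := by gcongr; exact norm_sub_le _ _
    linarith [sq_nonneg (‖M₁‖ - ‖M‖)]
  rw [h1]
  refine add_le_add (by gcongr) (mul_le_mul_of_nonneg_left ?_ (by positivity))
  rw [Finset.mul_sum]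
  refine Finset.sum_le_sum fun t ht => mul_le_mul_of_nonneg_right ?_
    (leverage_nonneg (S.proxyLin H) hlam t)
  exact pow_le_pow_left₀ (norm_nonneg _) (hc.norm_proxyGradient_le hS ht (hONS.mem t)) 2

omit hc in
-- The dimension contributes `H m n`. The logarithm is at most of order `H²`, by `log T ≤ H` and the
-- crude `log (1 + x) ≤ x`.
theorem IsStableOn.sum_leverage_proxyLin_le (hlam : 0 < lam) (hH1 : 1 ≤ H)
    (hH : Real.log T ≤ δ * H) :
    ∑ s ∈ Finset.Icc 1 T, leverage lam (S.proxyLin H) s ≤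
      m * n * (1 + linBound W κ δ C_B ^ 2 / lam) * (H : ℝ) ^ 3 := by
  have h := sum_leverage_le (S.proxyLin H) hlam T (R := linBound W κ δ C_B * H)
    fun t ht M => hS.norm_proxyLin_le ht M
  refine h.trans ?_
  have hT : (1 : ℝ) ≤ T := by exact_mod_cast hS.one_le
  have hH1' : (1 : ℝ) ≤ H := by exact_mod_cast hH1
  set c := linBound W κ δ C_B
  have hlog : Real.log (1 + T * (c * H) ^ 2 / lam) ≤ (1 + c ^ 2 / lam) * (H : ℝ) ^ 2 := by
    have h0 : 0 ≤ (c * H) ^ 2 / lam := by positivity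
    calc Real.log (1 + T * (c * H) ^ 2 / lam) ≤ Real.log (T * (1 + (c * H) ^ 2 / lam)) := by
          apply Real.log_le_log (by positivity)
          rw [mul_add, mul_one, mul_div_assoc]
          linarith
      _ = Real.log T + Real.log (1 + (c * H) ^ 2 / lam) :=
          Real.log_mul (by positivity) (by positivity)
      _ ≤ H + (c * H) ^ 2 / lam := by
          have h1 := Real.log_le_sub_one_of_pos (by positivity : 0 < 1 + (c * H) ^ 2 / lam)
          have h2 : δ * H ≤ H := mul_le_of_le_one_left (by positivity) hS.δ_lt_one.le
          linarith
      _ ≤ (H : ℝ) ^ 2 + (c * H) ^ 2 / lam := by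
          gcongr
          exact le_self_pow₀ hH1' two_ne_zero
      _ = _ := by ring
  have hd : (Module.finrank ℝ (DRCParam n m H) : ℝ) = H * (m * n) := by
    rw [finrank_euclideanSpace]; simp
  rw [hd]
  calc _ ≤ (H : ℝ) * (m * n) * ((1 + c ^ 2 / lam) * (H : ℝ) ^ 2) := by gcongr
    _ = _ := by ring

end Bounds

end LTVProblem

/-! ### Assembly of the bounds. -/

theorem mainTheorem8 :
    ∃ k : ℕ, ∀ (n m : ℕ) (W κ δ C_B γ α L η lam b : ℝ),
      0 < δ → δ < 1 → 0 < α → 1 / α ≤ η → 0 < lam →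
      ∃ C : ℝ, ∀ (T H : ℕ), 2 ≤ T → Real.log T ≤ δ * H → H ≤ b * Real.log T →
        ∀ (S : LTVProblem n m) (M₁ : DRCParam n m H),
          (∀ t ∈ Finset.Icc 0 T, ‖S.w t‖ ≤ W) →
          (∀ t ∈ Finset.Icc 1 T, ‖S.B t‖ ≤ C_B) →
          (∀ t ∈ Finset.Icc 1 T, ‖S.K t‖ ≤ κ) →
          S.SeqStabilizing T κ δ →
          (∀ t ∈ Finset.Icc 1 T, Differentiable ℝ (S.c t)) →
          (∀ t ∈ Finset.Icc 1 T, StrongConvexOn Set.univ α (S.c t)) →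
          (∀ t ∈ Finset.Icc 1 T, ∀ (x : Vec n) (u : Vec m),
            ‖gradient (S.c t) (WithLp.toLp 2 (x, u))‖ ≤ L * max 1 (‖x‖ + ‖u‖)) →
          M₁ ∈ DRCParam.constraintSet n m H γ →
          (∀ M ∈ DRCParam.constraintSet n m H γ,
            ∑ t ∈ Finset.Icc 1 T, S.cost (S.drcONS γ η lam M₁) t
              - ∑ t ∈ Finset.Icc 1 T, S.cost (fun _ => M) t ≤ C * Real.log T ^ k) ∧
          S.stabilityGap T (S.drcONS γ η lam M₁) ≤ C * Real.log T ^ k := by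
  -- The exponent comes from the stability gap: `H³` for the sum of leverages times `H²` for the
  -- windows.
  refine ⟨5, fun n m W κ δ C_B γ α L η lam b hδ hδ1 hα hη hlam => ?_⟩
  have hη0 : 0 < η := lt_of_lt_of_le (by positivity) hη
  have hηα : 1 ≤ η * α := (div_le_iff₀ hα).1 hη
  let G := LTVProblem.gradBound W κ δ C_B γ L
  let Q : ℝ := m * n * (1 + LTVProblem.linBound W κ δ C_B ^ 2 / lam)
  let trunc := G * ((1 + κ) * ((1 + κ) * LTVProblem.stateBound W κ δ C_B γ))
  let gap := 2 * η * C_B * (1 + κ) ^ 3 * G ^ 2 * Q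
  let reg := lam / (2 * η) * (4 * (m * n * γ ^ 2)) + η / 2 * (G ^ 2 * Q)
  -- Truncation occurs twice, for the algorithm and for the comparator; `b ^ 5` converts `H ^ 5`
  -- into `log T ^ 5`.
  refine ⟨(2 * trunc + gap + reg) * b ^ 5, ?_⟩
  intro T H hT hH hHb S M₁ hw hB hK hstab hdiff hconv hgrad hM₁
  have hS : S.IsStableOn T W κ δ C_B := ⟨hδ, hδ1, by omega, hw, hB, hK, hstab⟩
  have hc : S.HasRegularCosts T α L := ⟨hα, hdiff, hconv, hgrad⟩
  have hlogT : 0 < Real.log T := Real.log_pos (by exact_mod_cast hT)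
  have hH1 : 1 ≤ H := by
    rcases Nat.eq_zero_or_pos H with rfl | h
    · simp at hH; linarith
    · exact h
  have hH1' : (1 : ℝ) ≤ H := by exact_mod_cast hH1
  have hγ : 0 ≤ γ := (Finset.sum_nonneg fun _ _ => norm_nonneg _).trans hM₁
  have hκ := hS.κ_nonneg
  have hCB := hS.C_B_nonneg
  have hX := hS.stateBound_nonneg hγ
  have hG : 0 ≤ G := hc.gradBound_nonneg hS
  have hQ : 0 ≤ Q := by positivity
  have htrunc : 0 ≤ trunc := by positivity
  have hgap0 : 0 ≤ gap := by positivity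
  have hreg0 : 0 ≤ reg := by positivity
  have hlev := hS.sum_leverage_proxyLin_le (H := H) hlam hH1 hH
  have hpow : (H : ℝ) ^ 5 ≤ b ^ 5 * Real.log T ^ 5 := by
    rw [← mul_pow]; gcongr
  have hH5 : (1 : ℝ) ≤ (H : ℝ) ^ 5 := one_le_pow₀ hH1'
  have hgap : S.stabilityGap T (S.drcONS γ η lam M₁) ≤ gap * (H : ℝ) ^ 5 := by
    refine (hc.stabilityGap_drcONS_le hS hlam hη0 hM₁).trans ?_
    calc _ ≤ 2 * η * C_B * (1 + κ) ^ 3 * G ^ 2 * H ^ 2 * (Q * (H : ℝ) ^ 3) := by gcongr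
      _ = gap * (H : ℝ) ^ 5 := by simp only [gap]; ring
  have htotal : ∀ r, r ≤ (2 * trunc + gap + reg) * (H : ℝ) ^ 5 →
      r ≤ (2 * trunc + gap + reg) * b ^ 5 * Real.log T ^ 5 := fun r hr => by
    rw [mul_assoc]
    exact hr.trans (mul_le_mul_of_nonneg_left hpow (by positivity))
  refine ⟨fun M hM => htotal _ ?_, htotal _ ?_⟩
  · have hONS := hc.isOnlineNewton_drcONS (η := η) hlam hM₁
    have h1 := hc.sum_abs_cost_sub_memoryLoss_le hS hH hONS.mem
    have h2 := hc.sum_abs_cost_sub_memoryLoss_le hS hH (M := fun _ => M) fun _ => hM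
    have h3 := hc.sum_surrogateLoss_sub_le hS hlam hη0 hηα hM₁ hM
    have hreg : lam / (2 * η) * (4 * (H * (m * n) * γ ^ 2)) + η / 2 * (G ^ 2
        * ∑ s ∈ Finset.Icc 1 T, leverage lam (S.proxyLin H) s) ≤ reg * (H : ℝ) ^ 5 := by
      calc _ ≤ lam / (2 * η) * (4 * ((H : ℝ) ^ 5 * (m * n) * γ ^ 2))
            + η / 2 * (G ^ 2 * (Q * (H : ℝ) ^ 5)) := by
            gcongr
            · exact le_self_pow₀ hH1' (by norm_num)
            · refine hlev.trans ?_
              gcongr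
              norm_num
        _ = reg * (H : ℝ) ^ 5 := by simp only [reg]; ring
    have hsplit : ∑ t ∈ Finset.Icc 1 T, S.cost (S.drcONS γ η lam M₁) t
        - ∑ t ∈ Finset.Icc 1 T, S.cost (fun _ => M) t ≤
        ∑ t ∈ Finset.Icc 1 T,
            |S.cost (S.drcONS γ η lam M₁) t - S.memoryLoss (S.drcONS γ η lam M₁) t|
          + S.stabilityGap T (S.drcONS γ η lam M₁)
          + ∑ t ∈ Finset.Icc 1 T,
            (S.surrogateLoss t (S.drcONS γ η lam M₁ t) - S.surrogateLoss t M)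
          + ∑ t ∈ Finset.Icc 1 T, |S.cost (fun _ => M) t - S.memoryLoss (fun _ => M) t| := by
      rw [LTVProblem.stabilityGap, ← Finset.sum_sub_distrib, ← Finset.sum_add_distrib,
        ← Finset.sum_add_distrib, ← Finset.sum_add_distrib]
      refine Finset.sum_le_sum fun t _ => ?_
      have e : S.surrogateLoss t M = S.memoryLoss (fun _ => M) t := rfl
      have a1 := le_abs_self (S.cost (S.drcONS γ η lam M₁) t - S.memoryLoss (S.drcONS γ η lam M₁) t)
      have a2 := le_abs_self (S.memoryLoss (S.drcONS γ η lam M₁) t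
        - S.surrogateLoss t (S.drcONS γ η lam M₁ t))
      have a3 := neg_abs_le (S.cost (fun _ => M) t - S.memoryLoss (fun _ => M) t)
      linarith
    have h4 : trunc ≤ trunc * (H : ℝ) ^ 5 := le_mul_of_one_le_right htrunc hH5
    linarith
  · refine hgap.trans ?_
    gcongr
    linarith
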